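/- Let $X$ be a locally compact Hausdorff space and let $\mathcal H$ be a subgroup of the homeomorphism group of $X$, with the compact-open topology. Let $G$ be a locally compact topological group and let $\varphi,\varphi':G\to\mathcal H$ be continuous group homomorphisms that are homotopic through group homomorphisms: there is a continuous map $G\times[0,1]\to\mathcal H$, $(g,s)\mapsto\varphi^s(g)$, with $\varphi^0=\varphi$, $\varphi^1=\varphi'$ and every $\varphi^s$ a group homomorphism. For $n\ge 1$ let $EG(n)=G*\cdots*G$ be the $n$-fold Milnor join (with the coarsest topology making the coordinates $t_i:EG(n)\to[0,1]$ and $g_i:t_i^{-1}(0,1]\to G$ continuous), $BG(n)=EG(n)/G$, $X_\varphi(n)=EG(n)\times_\varphi X$ (the quotient of $EG(n)\times X$ by $(eg,x)\sim(e,\varphi(g)x)$), and $\pi_n:X_\varphi(n)\to BG(n)$ the projection. The equivariant cohomology of $X$ with compact supports and constant coefficients $\mathbb C$ is $$H^i_{\varphi,c}(X;\mathbb C)=\varprojlim_n H^i\big(BG(n);\,R(\pi_n)_!\,\mathbb C_{X_\varphi(n)}\big),$$ where $(\pi_n)_!$ is the direct image with proper supports for sheaves of $\mathbb C$-vector spaces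 and the limit is taken along the restriction maps induced by $BG(n)\subset BG(n+1)$ and $X_\varphi(n)\subset X_\varphi(n+1)$. Then for every $i\in\mathbb Z$ there is an isomorphism of $\mathbb C$-vector spaces $$H^i_{\varphi,c}(X;\mathbb C)\;\cong\;H^i_{\varphi',c}(X;\mathbb C).$$ -/

import Mathlib

universe u

noncomputable section

namespace DefAct

open CategoryTheory TopologicalSpace Limits Opposite

section Derived

variable {C D E : Type*} [Category* C] [Category* D] [Category* E]
  [Abelian C] [Abelian D] [Abelian E]
  [HasDerivedCategory C] [HasDerivedCategory D] [HasDerivedCategory E]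

/-- The natural transformation between functors of bounded below homotopy categories induced by
a natural transformation of additive functors. -/
def homotopyPlusMap {F G : C ⥤ D} [F.Additive] [G.Additive] (τ : F ⟶ G) :
    F.mapHomotopyCategoryPlus ⟶ G.mapHomotopyCategoryPlus where
  app K := ObjectProperty.homMk ((NatTrans.mapHomotopyCategory τ (.up ℤ)).app K.obj)
  naturality K L f := by
    ext
    exact (NatTrans.mapHomotopyCategory τ (.up ℤ)).naturality f.hom

/-- A complex concentrated in degree `0` is sent to such a complex by every additive functor. -/
def mapSingle (F : C ⥤ D) [F.Additive] (A : C) :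
    (HomotopyCategory.Plus.singleFunctor D 0).obj (F.obj A) ⟶
      F.mapHomotopyCategoryPlus.obj ((HomotopyCategory.Plus.singleFunctor C 0).obj A) :=
  ObjectProperty.homMk ((HomotopyCategory.quotient D (.up ℤ)).map
    ((F.mapCochainComplexSingleFunctor 0).inv.app A))

variable [EnoughInjectives C]

/-- The natural transformation `RF ⟶ RG` induced by `τ : F ⟶ G`. -/
def derivedMap {F G : C ⥤ D} [F.Additive] [G.Additive] (τ : F ⟶ G) :
    F.rightDerivedFunctorPlus ⟶ G.rightDerivedFunctorPlus :=
  Functor.rightDerivedNatTrans _ _ F.rightDerivedFunctorPlusUnit G.rightDerivedFunctorPlusUnit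
    (HomotopyCategory.Plus.quasiIso C)
    (Functor.whiskerRight (homotopyPlusMap τ) DerivedCategory.Plus.Qh)

/-- The canonical morphism `F(A) ⟶ RF(A)` for an object `A`, seen in degree `0`. -/
def toDerived (F : C ⥤ D) [F.Additive] (A : C) :
    (DerivedCategory.Plus.singleFunctor D 0).obj (F.obj A) ⟶
      F.rightDerivedFunctorPlus.obj ((DerivedCategory.Plus.singleFunctor C 0).obj A) :=
  DerivedCategory.Plus.Qh.map (mapSingle F A) ≫
    F.rightDerivedFunctorPlusUnit.app ((HomotopyCategory.Plus.singleFunctor C 0).obj A)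

variable [EnoughInjectives D]

/-- The composite `H(K) ≅ G(F(K)) ⟶ RG(F(K)) ⟶ RG(RF(K))` for `H ≅ F ⋙ G`, natural in the
bounded below complex `K`. -/
def derivedCompUnit {F : C ⥤ D} {G : D ⥤ E} {H : C ⥤ E} [F.Additive] [G.Additive] [H.Additive]
    (e : F ⋙ G ≅ H) :
    H.mapHomotopyCategoryPlus ⋙ DerivedCategory.Plus.Qh ⟶
      DerivedCategory.Plus.Qh ⋙ F.rightDerivedFunctorPlus ⋙ G.rightDerivedFunctorPlus where
  app K :=
    DerivedCategory.Plus.Qh.map ((Functor.mapHomotopyCategoryPlusCompIso e).inv.app K) ≫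
      G.rightDerivedFunctorPlusUnit.app (F.mapHomotopyCategoryPlus.obj K) ≫
        G.rightDerivedFunctorPlus.map (F.rightDerivedFunctorPlusUnit.app K)
  naturality K L f := by
    have h₁ := (Functor.mapHomotopyCategoryPlusCompIso e).inv.naturality f
    have h₂ := G.rightDerivedFunctorPlusUnit.naturality (F.mapHomotopyCategoryPlus.map f)
    have h₃ := F.rightDerivedFunctorPlusUnit.naturality f
    dsimp at h₁ h₂ h₃ ⊢
    rw [← Functor.map_comp_assoc, h₁, Functor.map_comp_assoc, Category.assoc, Category.assoc,
      reassoc_of% h₂, ← Functor.map_comp, h₃, Functor.map_comp]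

/-- The canonical natural transformation `RH ⟶ RF ⋙ RG` for `H ≅ F ⋙ G`. -/
def derivedComp {F : C ⥤ D} {G : D ⥤ E} {H : C ⥤ E} [F.Additive] [G.Additive] [H.Additive]
    (e : F ⋙ G ≅ H) :
    H.rightDerivedFunctorPlus ⟶ F.rightDerivedFunctorPlus ⋙ G.rightDerivedFunctorPlus :=
  Functor.rightDerivedDesc _ H.rightDerivedFunctorPlusUnit (HomotopyCategory.Plus.quasiIso C) _
    (derivedCompUnit e)

/-- If `F` preserves injective objects, then the derived functor of the composite is the composite
of the derived functors. -/
lemma isIso_derivedComp {F : C ⥤ D} {G : D ⥤ E} {H : C ⥤ E} [F.Additive] [G.Additive] [H.Additive]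
    (e : F ⋙ G ≅ H) (hF : ∀ I : C, Injective I → Injective (F.obj I)) :
    IsIso (derivedComp e) := by
  refine (Functor.isRightDerivedFunctor_iff_isIso_rightDerivedDesc _ H.rightDerivedFunctorPlusUnit
    (HomotopyCategory.Plus.quasiIso C) _ (derivedCompUnit e)).mp ?_
  refine (HomotopyCategory.Plus.localizerMorphism_derives
    (H.mapHomotopyCategoryPlus ⋙ DerivedCategory.Plus.Qh)).isRightDerivedFunctor_of_isIso
    (derivedCompUnit e) ?_
  intro K
  have inj : ∀ n : ℤ, Injective ((F.mapHomotopyCategoryPlus.obj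
      ((InjectiveObject.ι C).mapHomotopyCategoryPlus.obj K)).obj.as.X n) := fun n =>
    hF _ (inferInstanceAs (Injective (((InjectiveObject.ι C).mapHomotopyCategoryPlus.obj
      K).obj.as.X n)))
  have : IsIso (G.rightDerivedFunctorPlusUnit.app (F.mapHomotopyCategoryPlus.obj
      ((InjectiveObject.ι C).mapHomotopyCategoryPlus.obj K))) := inferInstance
  have : IsIso (F.rightDerivedFunctorPlusUnit.app
      ((InjectiveObject.ι C).mapHomotopyCategoryPlus.obj K)) := inferInstance
  dsimp [derivedCompUnit]
  infer_instance

end Derived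

section Proper

variable {X Y : Type*} [TopologicalSpace X] [TopologicalSpace Y]

/-- `S` is proper over `U`: `f` maps `S` into `U` and restricts to a proper map `S → U`. -/
def ProperOver (f : X → Y) (S : Set X) (U : Set Y) : Prop :=
  ∃ h : Set.MapsTo f S U, IsProperMap (h.restrict f S U)

lemma properOver_iff {f : X → Y} (hf : Continuous f) {S : Set X} {U : Set Y} :
    ProperOver f S U ↔ Set.MapsTo f S U ∧ ∀ 𝒰 : Ultrafilter X, S ∈ 𝒰 → ∀ y ∈ U,
      Filter.Tendsto f 𝒰 (nhds y) → ∃ x ∈ S, f x = y ∧ (𝒰 : Filter X) ≤ nhds x := by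
  constructor
  · rintro ⟨h, hp⟩
    refine ⟨h, fun 𝒰 hS y hy hlim => ?_⟩
    have hS' : Set.range (Subtype.val : S → X) ∈ 𝒰 := by simpa using hS
    let 𝒱 : Ultrafilter S := 𝒰.comap Subtype.val_injective hS'
    have h𝒱 : Filter.map Subtype.val (𝒱 : Filter S) = 𝒰 := by
      change Filter.map Subtype.val (Filter.comap Subtype.val (𝒰 : Filter X)) = 𝒰
      exact Filter.map_comap_of_mem hS'
    have hlim' : Filter.Tendsto (h.restrict f S U) 𝒱 (nhds ⟨y, hy⟩) := by
      rw [tendsto_subtype_rng]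
      change Filter.Tendsto (f ∘ Subtype.val) (𝒱 : Filter S) (nhds y)
      rw [← Filter.tendsto_map'_iff, h𝒱]
      exact hlim
    obtain ⟨x, hx, hle⟩ := (isProperMap_iff_ultrafilter.mp hp).2 hlim'
    refine ⟨x, x.2, congrArg Subtype.val hx, ?_⟩
    rw [← h𝒱]
    exact (Filter.map_mono hle).trans continuous_subtype_val.continuousAt
  · rintro ⟨h, hu⟩
    refine ⟨h, isProperMap_iff_ultrafilter.mpr ⟨hf.restrict h, fun 𝒱 y hlim => ?_⟩⟩
    obtain ⟨x, hx, hxy, hle⟩ := hu (𝒱.map Subtype.val)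
      (by
        change S ∈ Filter.map Subtype.val (𝒱 : Filter S)
        simp) y y.2
      (by
        rw [Ultrafilter.coe_map, Filter.tendsto_map'_iff]
        exact (tendsto_subtype_rng.mp hlim))
    refine ⟨⟨x, hx⟩, Subtype.ext hxy, ?_⟩
    rw [nhds_subtype_eq_comap]
    exact Filter.map_le_iff_le_comap.mp hle

lemma ProperOver.empty (f : X → Y) (hf : Continuous f) (U : Set Y) : ProperOver f ∅ U :=
  (properOver_iff hf).mpr ⟨fun _ h => h.elim, fun 𝒰 h => (𝒰.empty_notMem h).elim⟩

/-- A relatively closed subset of a union of two sets proper over `U` is proper over `U`. -/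
lemma ProperOver.of_subset_union {f : X → Y} (hf : Continuous f) {S T A : Set X} {U : Set Y}
    (hS : ProperOver f S U) (hT : ProperOver f T U) (hA : A ⊆ S ∪ T)
    (hcl : ∀ x ∈ f ⁻¹' U, x ∈ closure A → x ∈ A) : ProperOver f A U := by
  rw [properOver_iff hf] at hS hT ⊢
  have key : ∀ B : Set X, (Set.MapsTo f B U ∧ ∀ 𝒰 : Ultrafilter X, B ∈ 𝒰 → ∀ y ∈ U,
      Filter.Tendsto f 𝒰 (nhds y) → ∃ x ∈ B, f x = y ∧ (𝒰 : Filter X) ≤ nhds x) →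
      ∀ 𝒰 : Ultrafilter X, B ∈ 𝒰 → A ∈ 𝒰 → ∀ y ∈ U, Filter.Tendsto f 𝒰 (nhds y) →
      ∃ x ∈ A, f x = y ∧ (𝒰 : Filter X) ≤ nhds x := by
    intro B hB 𝒰 hB𝒰 hA𝒰 y hy hlim
    obtain ⟨x, -, hxy, hle⟩ := hB.2 𝒰 hB𝒰 y hy hlim
    refine ⟨x, hcl x (by simpa [hxy] using hy) ?_, hxy, hle⟩
    exact mem_closure_iff_ultrafilter.mpr ⟨𝒰, hA𝒰, hle⟩
  refine ⟨fun x hx => (hA hx).elim (fun h => hS.1 h) (fun h => hT.1 h), fun 𝒰 h𝒰 y hy hlim => ?_⟩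
  rcases Ultrafilter.union_mem_iff.mp (Filter.mem_of_superset h𝒰 hA) with h | h
  · exact key S hS 𝒰 h h𝒰 y hy hlim
  · exact key T hT 𝒰 h h𝒰 y hy hlim

/-- Properness is stable under restriction to a smaller base. -/
lemma ProperOver.restrict {f : X → Y} (hf : Continuous f) {S : Set X} {U V : Set Y}
    (hS : ProperOver f S U) (hVU : V ⊆ U) : ProperOver f (S ∩ f ⁻¹' V) V := by
  rw [properOver_iff hf] at hS ⊢
  refine ⟨fun x hx => hx.2, fun 𝒰 h𝒰 y hy hlim => ?_⟩
  obtain ⟨x, hx, hxy, hle⟩ := hS.2 𝒰 (Filter.mem_of_superset h𝒰 Set.inter_subset_left) y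
    (hVU hy) hlim
  exact ⟨x, ⟨hx, by simpa [hxy] using hy⟩, hxy, hle⟩

/-- Properness is local on the base. -/
lemma ProperOver.of_cover {f : X → Y} (hf : Continuous f) {S : Set X} {ι : Type*} {U : ι → Set Y}
    (hU : ∀ i, IsOpen (U i)) (hSU : Set.MapsTo f S (⋃ i, U i))
    (hS : ∀ i, ProperOver f (S ∩ f ⁻¹' (U i)) (U i)) : ProperOver f S (⋃ i, U i) := by
  rw [properOver_iff hf]
  refine ⟨hSU, fun 𝒰 h𝒰 y hy hlim => ?_⟩
  obtain ⟨i, hi⟩ := Set.mem_iUnion.mp hy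
  obtain ⟨x, hx, hxy, hle⟩ := ((properOver_iff hf).mp (hS i)).2 𝒰
    (Filter.inter_mem h𝒰 (hlim ((hU i).mem_nhds hi))) y hi hlim
  exact ⟨x, hx.1, hxy, hle⟩

/-- Properness passes to the source of a commutative square `j ∘ f' = f ∘ ψ` with `ψ` proper and
`j` injective. -/
lemma ProperOver.pullback {X' Y' : Type*} [TopologicalSpace X'] [TopologicalSpace Y']
    {f : X → Y} {f' : X' → Y'} {ψ : X' → X} {j : Y' → Y} (hf : Continuous f)
    (hf' : Continuous f') (hj : Continuous j) (hj' : Function.Injective j) (hψ : IsProperMap ψ)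
    (comm : ∀ x, j (f' x) = f (ψ x)) {S : Set X} {U : Set Y} {A : Set X'}
    (hS : ProperOver f S U) (hA : Set.MapsTo ψ A S)
    (hcl : ∀ x ∈ f' ⁻¹' (j ⁻¹' U), x ∈ closure A → x ∈ A) : ProperOver f' A (j ⁻¹' U) := by
  rw [properOver_iff hf] at hS
  rw [properOver_iff hf']
  refine ⟨fun x hx => ?_, fun 𝒰 h𝒰 y hy hlim => ?_⟩
  · change j (f' x) ∈ U
    rw [comm]
    exact hS.1 (hA hx)
  · have hlim' : Filter.Tendsto f (𝒰.map ψ) (nhds (j y)) := by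
      rw [Ultrafilter.coe_map, Filter.tendsto_map'_iff]
      have : f ∘ ψ = j ∘ f' := funext fun x => (comm x).symm
      rw [this]
      exact (hj.tendsto y).comp hlim
    obtain ⟨x, -, hxy, hle⟩ := hS.2 (𝒰.map ψ)
      (show ψ ⁻¹' S ∈ 𝒰 from Filter.mem_of_superset h𝒰 hA) (j y) hy hlim'
    obtain ⟨x', hx', hle'⟩ := (isProperMap_iff_ultrafilter.mp hψ).2
      (show Filter.Tendsto ψ 𝒰 (nhds x) from hle)
    have hfy : f' x' = y := hj' (by rw [comm, hx', hxy])
    refine ⟨x', hcl x' (by simpa [hfy] using hy) ?_, hfy, hle'⟩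
    exact mem_closure_iff_ultrafilter.mpr ⟨𝒰, h𝒰, hle'⟩

end Proper

section Sheaves

variable (R : Type u) [CommRing R]

/-- The category of sheaves of `R`-modules on `X`. -/
abbrev Sh (X : TopCat.{u}) := TopCat.Sheaf (ModuleCat.{u} R) X

variable {R} {X Y : TopCat.{u}}

/-- The restriction of a section to a smaller open set. -/
def res (F : Sh R X) {V W : Opens X} (h : W ≤ V) : F.obj.obj (op V) →ₗ[R] F.obj.obj (op W) :=
  (F.obj.map (homOfLE h).op).hom

lemma res_res (F : Sh R X) {V W Z : Opens X} (h : W ≤ V) (h' : Z ≤ W) (s : F.obj.obj (op V)) :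
    res F h' (res F h s) = res F (h'.trans h) s := by
  change (F.obj.map (homOfLE h).op ≫ F.obj.map (homOfLE h').op).hom s = _
  rw [← F.obj.map_comp]
  rfl

lemma res_self (F : Sh R X) {V : Opens X} (h : V ≤ V) (s : F.obj.obj (op V)) :
    res F h s = s := by
  change (F.obj.map (𝟙 (op V))).hom s = _
  rw [F.obj.map_id]
  rfl

lemma res_map {F G : Sh R X} (φ : F ⟶ G) {V W : Opens X} (h : W ≤ V) (s : F.obj.obj (op V)) :
    (φ.hom.app (op W)).hom (res F h s) = res G h ((φ.hom.app (op V)).hom s) := by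
  change (F.obj.map (homOfLE h).op ≫ φ.hom.app (op W)).hom s = _
  rw [φ.hom.naturality]
  rfl

/-- The support of a section of `F` over `V`: the points of `V` no neighbourhood of which the
section vanishes on. -/
def supp (F : Sh R X) {V : Opens X} (s : F.obj.obj (op V)) : Set X :=
  {x | x ∈ V ∧ ∀ (W : Opens X) (h : W ≤ V), x ∈ W → res F h s ≠ 0}

lemma supp_closed (F : Sh R X) {V : Opens X} (s : F.obj.obj (op V)) (x : X) (hx : x ∈ V)
    (hcl : x ∈ closure (supp F s)) : x ∈ supp F s := by
  refine ⟨hx, fun W h hxW => ?_⟩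
  obtain ⟨y, hyW, hy⟩ := mem_closure_iff.mp hcl W W.isOpen hxW
  exact hy.2 W h hyW

lemma supp_zero (F : Sh R X) (V : Opens X) : supp F (0 : F.obj.obj (op V)) = ∅ := by
  ext x
  simp only [Set.mem_empty_iff_false, iff_false]
  exact fun h => h.2 V le_rfl h.1 (map_zero _)

lemma supp_add (F : Sh R X) {V : Opens X} (s t : F.obj.obj (op V)) :
    supp F (s + t) ⊆ supp F s ∪ supp F t := by
  intro x hx
  by_contra hcon
  simp only [Set.mem_union, not_or, supp, Set.mem_ofPred_eq, not_and, not_forall,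
    not_not] at hcon
  obtain ⟨W, hW, hxW, h0⟩ := hcon.1 hx.1
  obtain ⟨W', hW', hxW', h0'⟩ := hcon.2 hx.1
  refine hx.2 (W ⊓ W') (inf_le_left.trans hW) ⟨hxW, hxW'⟩ ?_
  rw [map_add, ← res_res F hW inf_le_left, ← res_res F hW' inf_le_right, h0, h0', map_zero,
    map_zero, add_zero]

lemma supp_smul (F : Sh R X) {V : Opens X} (c : R) (s : F.obj.obj (op V)) :
    supp F (c • s) ⊆ supp F s := fun x hx => ⟨hx.1, fun W h hxW h0 => hx.2 W h hxW (by
  rw [map_smul, h0, smul_zero])⟩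

lemma supp_res (F : Sh R X) {V W : Opens X} (h : W ≤ V) (s : F.obj.obj (op V)) :
    supp F (res F h s) = supp F s ∩ W := by
  ext x
  constructor
  · rintro ⟨hxW, hx⟩
    refine ⟨⟨h hxW, fun Z hZ hxZ h0 => hx (Z ⊓ W) inf_le_right ⟨hxZ, hxW⟩ ?_⟩, hxW⟩
    rw [res_res, ← res_res F hZ inf_le_left, h0, map_zero]
  · rintro ⟨⟨_, hx⟩, hxW⟩
    refine ⟨hxW, fun Z hZ hxZ h0 => hx Z (hZ.trans h) hxZ ?_⟩
    rwa [res_res] at h0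

lemma supp_map {F G : Sh R X} (φ : F ⟶ G) {V : Opens X} (s : F.obj.obj (op V)) :
    supp G ((φ.hom.app (op V)).hom s) ⊆ supp F s := fun x hx =>
  ⟨hx.1, fun W h hxW h0 => hx.2 W h hxW (by rw [← res_map, h0, map_zero])⟩

/-- The sections of `F` over `f ⁻¹ U` whose support is proper over `U`. -/
def properSections (f : X ⟶ Y) (F : Sh R X) (U : Opens Y) :
    Submodule R (F.obj.obj (op ((Opens.map f).obj U))) where
  carrier := {s | ProperOver f (supp F s) U}
  zero_mem' := by
    change ProperOver f (supp F 0) U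
    rw [supp_zero]
    exact ProperOver.empty _ f.hom.continuous _
  add_mem' {s t} hs ht := ProperOver.of_subset_union f.hom.continuous hs ht (supp_add F s t)
    (fun x hx => supp_closed F _ x hx)
  smul_mem' c s hs := ProperOver.of_subset_union f.hom.continuous hs hs
    ((supp_smul F c s).trans Set.subset_union_left) (fun x hx => supp_closed F _ x hx)

lemma res_mem (f : X ⟶ Y) (F : Sh R X) {U V : Opens Y} (h : V ≤ U)
    {s : F.obj.obj (op ((Opens.map f).obj U))} (hs : s ∈ properSections f F U) :
    res F ((Opens.map f).monotone h) s ∈ properSections f F V := by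
  change ProperOver f (supp F _) V
  rw [supp_res]
  exact ProperOver.restrict f.hom.continuous hs h

/-- The presheaf `U ↦ {s ∈ F(f ⁻¹ U) | supp s is proper over U}`. -/
def shriekPresheaf (f : X ⟶ Y) (F : Sh R X) : TopCat.Presheaf (ModuleCat.{u} R) Y where
  obj U := ModuleCat.of R (properSections f F U.unop)
  map {U V} i := ModuleCat.ofHom ((res F ((Opens.map f).monotone i.unop.le)).restrict
    (fun _ hs => res_mem f F i.unop.le hs))
  map_id U := by
    ext s
    exact res_self F _ _
  map_comp i j := by
    ext s
    exact (res_res F _ _ _).symm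

lemma shriekPresheaf_isSheaf (f : X ⟶ Y) (F : Sh R X) : (shriekPresheaf f F).IsSheaf := by
  rw [TopCat.Presheaf.isSheaf_iff_isSheaf_comp (forget (ModuleCat.{u} R)),
    TopCat.Presheaf.isSheaf_iff_isSheafUniqueGluing_types]
  intro ι U sf hsf
  have hc : TopCat.Presheaf.IsCompatible ((TopCat.Sheaf.pushforward (ModuleCat.{u} R) f).obj F).obj
      U (fun i => (sf i).1) := fun i k => congrArg Subtype.val (hsf i k)
  obtain ⟨s, hs, huniq⟩ := TopCat.Sheaf.existsUnique_gluing
    ((TopCat.Sheaf.pushforward (ModuleCat.{u} R) f).obj F) U (fun i => (sf i).1) hc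
  have hs' : ∀ i, res F ((Opens.map f).monotone (le_iSup U i)) s = (sf i).1 := hs
  have hmem : s ∈ properSections f F (iSup U) := by
    change ProperOver f (supp F s) (iSup U : Opens Y)
    rw [Opens.coe_iSup]
    refine ProperOver.of_cover f.hom.continuous (fun i => (U i).isOpen) (fun x hx => ?_)
      (fun i => ?_)
    · have := hx.1
      rw [← Opens.coe_iSup]
      exact this
    · have h : ProperOver f (supp F (res F ((Opens.map f).monotone (le_iSup U i)) s)) (U i) := by
        rw [hs' i]
        exact (sf i).2
      exact (supp_res F ((Opens.map f).monotone (le_iSup U i)) s) ▸ h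
  refine ⟨⟨s, hmem⟩, fun i => Subtype.ext (hs' i), fun t ht => Subtype.ext ?_⟩
  exact huniq t.1 (fun i => congrArg Subtype.val (ht i))

/-- The direct image with proper supports `f_! : Sh(X) ⥤ Sh(Y)`. -/
def shriek (f : X ⟶ Y) : Sh R X ⥤ Sh R Y where
  obj F := ⟨shriekPresheaf f F, shriekPresheaf_isSheaf f F⟩
  map {F G} φ := ObjectProperty.homMk
    { app := fun U => ModuleCat.ofHom (((φ.hom.app (op ((Opens.map f).obj U.unop))).hom).restrict
        (fun s hs => ProperOver.of_subset_union f.hom.continuous hs hs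
          ((supp_map φ s).trans Set.subset_union_left) (fun x hx => supp_closed G _ x hx)))
      naturality := fun U V i => by
        ext s
        apply Subtype.ext
        exact res_map φ _ _ }

instance (f : X ⟶ Y) : (shriek (R := R) f).Additive where
  map_add := rfl

instance (f : X ⟶ Y) : (TopCat.Sheaf.pushforward (ModuleCat.{u} R) f).Additive where
  map_add := rfl

/-- The global sections functor `Γ(X, -)`. -/
def globalSections (X : TopCat.{u}) : Sh R X ⥤ ModuleCat.{u} R :=
  TopCat.Sheaf.forget (ModuleCat.{u} R) X ⋙ (evaluation _ _).obj (op ⊤)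

instance (X : TopCat.{u}) : (globalSections (R := R) X).Additive where
  map_add := rfl

lemma injective_pushforward (f : X ⟶ Y) (I : Sh R X) (hI : Injective I) :
    Injective ((TopCat.Sheaf.pushforward (ModuleCat.{u} R) f).obj I) := by
  have : PreservesFiniteLimits (TopCat.Sheaf.pullback (ModuleCat.{u} R) f) :=
    Functor.SmallCategories.instPreservesFiniteLimitsSheafSheafPullbackOfRepresentablyFlat _ _ _ _
  exact Injective.injective_of_adjoint
    (TopCat.Sheaf.pullbackPushforwardAdjunction (ModuleCat.{u} R) f) I

variable {X' Y' : TopCat.{u}}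

/-- For a commutative square `f' ≫ j = ψ ≫ f` with `ψ` proper and `j` injective, the inclusion
`f_! ψ_* ⟶ j_* f'_!` of sheaves of sections. -/
def shriekPushforward (f : X ⟶ Y) (f' : X' ⟶ Y') (ψ : X' ⟶ X) (j : Y' ⟶ Y)
    (comm : f' ≫ j = ψ ≫ f) (hψ : IsProperMap ψ) (hj : Function.Injective j) :
    TopCat.Sheaf.pushforward (ModuleCat.{u} R) ψ ⋙ shriek f ⟶
      shriek f' ⋙ TopCat.Sheaf.pushforward (ModuleCat.{u} R) j :=
  have hc : ∀ x, j (f' x) = f (ψ x) := fun x => ConcreteCategory.congr_hom comm x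
  have hle : ∀ U : Opens Y, (Opens.map f').obj ((Opens.map j).obj U) ≤
      (Opens.map ψ).obj ((Opens.map f).obj U) := fun U x hx => by
    change f (ψ x) ∈ U
    rw [← hc]
    exact hx
  { app := fun F => ObjectProperty.homMk
      { app := fun U => ModuleCat.ofHom ((res F (hle U.unop)).restrict (fun s hs => by
          change ProperOver f' (supp F (res F (hle U.unop) s)) (j ⁻¹' U.unop)
          refine ProperOver.pullback (S := supp ((TopCat.Sheaf.pushforward _ ψ).obj F) s)
            f.hom.continuous f'.hom.continuous
            j.hom.continuous hj hψ hc hs (fun x hx => ?_) (fun x hx => supp_closed F _ x hx)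
          rw [supp_res] at hx
          exact ⟨hx.1.1, fun W hW hxW => hx.1.2 _ ((Opens.map ψ).monotone hW) hxW⟩))
        naturality := fun U V i => by
          ext s
          apply Subtype.ext
          exact (res_res F _ _ _).trans (res_res F _ _ _).symm }
    naturality := fun F G φ => ObjectProperty.hom_ext _ (NatTrans.ext (funext fun U =>
      ModuleCat.hom_ext (LinearMap.ext fun s => Subtype.ext (res_map φ (hle U.unop) _).symm))) }

/-- The constant sheaf with value `R`. -/
def constSheaf (R : Type u) [CommRing R] (X : TopCat.{u}) : Sh R X :=
  (constantSheaf (Opens.grothendieckTopology X) (ModuleCat.{u} R)).obj (ModuleCat.of R R)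

/-- The canonical morphism from the constant sheaf to the direct image of the constant sheaf; it is
adjoint to the isomorphism between the inverse image of the constant sheaf and the constant
sheaf, and determined by being the identity on constant global sections. -/
def constSheafMap (R : Type u) [CommRing R] (ψ : X' ⟶ X) :
    constSheaf R X ⟶ (TopCat.Sheaf.pushforward (ModuleCat.{u} R) ψ).obj (constSheaf R X') :=
  ((constantSheafAdj (Opens.grothendieckTopology X) (ModuleCat.{u} R)
      (isTerminalTop : IsTerminal (⊤ : Opens X))).homEquiv (ModuleCat.of R R)
      ((TopCat.Sheaf.pushforward (ModuleCat.{u} R) ψ).obj (constSheaf R X'))).symm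
    ((constantSheafAdj (Opens.grothendieckTopology X') (ModuleCat.{u} R)
      (isTerminalTop : IsTerminal (⊤ : Opens X'))).unit.app (ModuleCat.of R R))

instance : HasDerivedCategory (Sh R X) := HasDerivedCategory.standard _

instance : HasDerivedCategory (ModuleCat.{u} R) := HasDerivedCategory.standard _

/-- The object `R f_! R_X` of the bounded below derived category of sheaves on `Y`. -/
def derivedShriekConst (R : Type u) [CommRing R] (f : X ⟶ Y) : DerivedCategory.Plus (Sh R Y) :=
  (shriek f).rightDerivedFunctorPlus.obj
    ((DerivedCategory.Plus.singleFunctor _ 0).obj (constSheaf R X))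

/-- The object `RΓ(Y, K)` of the bounded below derived category of `R`-modules. -/
def derivedSections (K : DerivedCategory.Plus (Sh R Y)) :
    DerivedCategory.Plus (ModuleCat.{u} R) :=
  (globalSections Y).rightDerivedFunctorPlus.obj K

/-- The base change morphism `R f_! (Rψ_* K) ⟶ Rj_* (R f'_! K)` of a commutative square
`f' ≫ j = ψ ≫ f` with `ψ` proper and `j` injective. -/
def derivedBaseChange (f : X ⟶ Y) (f' : X' ⟶ Y') (ψ : X' ⟶ X) (j : Y' ⟶ Y)
    (comm : f' ≫ j = ψ ≫ f) (hψ : IsProperMap ψ) (hj : Function.Injective j) :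
    (TopCat.Sheaf.pushforward (ModuleCat.{u} R) ψ).rightDerivedFunctorPlus ⋙
        (shriek f).rightDerivedFunctorPlus ⟶
      (shriek f').rightDerivedFunctorPlus ⋙
        (TopCat.Sheaf.pushforward (ModuleCat.{u} R) j).rightDerivedFunctorPlus :=
  have := isIso_derivedComp
    (Iso.refl (TopCat.Sheaf.pushforward (ModuleCat.{u} R) ψ ⋙ shriek f)) (injective_pushforward ψ)
  inv (derivedComp (Iso.refl (TopCat.Sheaf.pushforward (ModuleCat.{u} R) ψ ⋙ shriek f))) ≫
    derivedMap (shriekPushforward f f' ψ j comm hψ hj) ≫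
    derivedComp (Iso.refl (shriek f' ⋙ TopCat.Sheaf.pushforward (ModuleCat.{u} R) j))

/-- The canonical identification `RΓ(Y, Rj_* K) ⟶ RΓ(Y', K)`. -/
def derivedSectionsPushforward (j : Y' ⟶ Y) (K : DerivedCategory.Plus (Sh R Y')) :
    derivedSections
        ((TopCat.Sheaf.pushforward (ModuleCat.{u} R) j).rightDerivedFunctorPlus.obj K) ⟶
      derivedSections K :=
  let e : TopCat.Sheaf.pushforward (ModuleCat.{u} R) j ⋙ globalSections Y ≅ globalSections Y' :=
    Iso.refl _
  have := isIso_derivedComp e (injective_pushforward j)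
  (inv (derivedComp e)).app K

/-- The restriction morphism `RΓ(Y, R f_! R_X) ⟶ RΓ(Y', R f'_! R_{X'})` along a commutative square
`f' ≫ j = ψ ≫ f` with `ψ` proper and `j` injective. -/
def derivedRestriction (R : Type u) [CommRing R] (f : X ⟶ Y) (f' : X' ⟶ Y') (ψ : X' ⟶ X)
    (j : Y' ⟶ Y) (comm : f' ≫ j = ψ ≫ f) (hψ : IsProperMap ψ) (hj : Function.Injective j) :
    derivedSections (derivedShriekConst R f) ⟶ derivedSections (derivedShriekConst R f') :=
  (globalSections Y).rightDerivedFunctorPlus.map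
    ((shriek f).rightDerivedFunctorPlus.map
      ((DerivedCategory.Plus.singleFunctor _ 0).map (constSheafMap R ψ) ≫
        toDerived (TopCat.Sheaf.pushforward (ModuleCat.{u} R) ψ) (constSheaf R X')) ≫
    (derivedBaseChange f f' ψ j comm hψ hj).app _) ≫
  derivedSectionsPushforward j (derivedShriekConst R f')

/-- The hypercohomology `Hⁱ(Y; R f_! R_X)`. -/
def shriekCohomology (R : Type u) [CommRing R] (f : X ⟶ Y) (i : ℤ) : ModuleCat.{u} R :=
  (DerivedCategory.Plus.homologyFunctor (ModuleCat.{u} R) i).obj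
    (derivedSections (derivedShriekConst R f))

/-- The restriction map `Hⁱ(Y; R f_! R_X) ⟶ Hⁱ(Y'; R f'_! R_{X'})`. -/
def shriekCohomologyMap (R : Type u) [CommRing R] (f : X ⟶ Y) (f' : X' ⟶ Y') (ψ : X' ⟶ X)
    (j : Y' ⟶ Y) (comm : f' ≫ j = ψ ≫ f) (hψ : IsProperMap ψ) (hj : Function.Injective j) (i : ℤ) :
    shriekCohomology R f i ⟶ shriekCohomology R f' i :=
  (DerivedCategory.Plus.homologyFunctor (ModuleCat.{u} R) i).map
    (derivedRestriction R f f' ψ j comm hψ hj)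

end Sheaves

section Milnor

/-- Points `⟨t₀ g₀, t₁ g₁, …⟩` of the infinite join `G * G * ⋯`: almost all `tᵢ` vanish, `tᵢ ≥ 0`,
`∑ tᵢ = 1`, and `gᵢ ∈ G` is part of the data only when `tᵢ > 0`. -/
structure MilnorE (G : Type*) where
  t : ℕ →₀ ℝ
  nonneg : ∀ i, 0 ≤ t i
  sum_eq_one : (t.sum fun _ r => r) = 1
  g : ∀ i, 0 < t i → G

variable {G : Type*}

/-- The coarsest topology for which all `tᵢ` and all `gᵢ : tᵢ⁻¹(0, 1] → G` are continuous, the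
sets `tᵢ⁻¹(0, 1]` being open. -/
instance [TopologicalSpace G] : TopologicalSpace (MilnorE G) :=
  TopologicalSpace.generateFrom
    ({A | ∃ (i : ℕ) (U : Set ℝ), IsOpen U ∧ A = {e | e.t i ∈ U}} ∪
      {A | ∃ (i : ℕ) (V : Set G), IsOpen V ∧ A = {e | ∃ h : 0 < e.t i, e.g i h ∈ V}})

lemma MilnorE.continuous_t [TopologicalSpace G] (i : ℕ) :
    Continuous fun e : MilnorE G => e.t i :=
  continuous_def.mpr fun U hU =>
    TopologicalSpace.isOpen_generateFrom_of_mem (Or.inl ⟨i, U, hU, rfl⟩)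

variable (G) in
/-- The `n`-fold join `EG(n) = G * ⋯ * G`: the subspace of the points with `tᵢ = 0` for `i ≥ n`. -/
abbrev EG (n : ℕ) [TopologicalSpace G] := {e : MilnorE G // ∀ i, n ≤ i → e.t i = 0}

variable [TopologicalSpace G]

/-- The inclusion `EG(n) ⊆ EG(n + 1)`. -/
def EG.incl {n : ℕ} (e : EG G n) : EG G (n + 1) := ⟨e.1, fun i h => e.2 i (by omega)⟩

lemma EG.isClosedEmbedding_incl (n : ℕ) :
    Topology.IsClosedEmbedding (EG.incl : EG G n → EG G (n + 1)) := by
  refine ⟨⟨⟨?_⟩, fun a b h => Subtype.ext (congrArg (fun e : EG G (n + 1) => e.1) h)⟩, ?_⟩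
  · change TopologicalSpace.induced _ _ = TopologicalSpace.induced _ (TopologicalSpace.induced _ _)
    rw [induced_compose]
    rfl
  · have : Set.range (EG.incl : EG G n → EG G (n + 1)) = {e | e.1.t n = 0} := by
      ext e
      constructor
      · rintro ⟨e, rfl⟩
        exact e.2 n le_rfl
      · intro h
        refine ⟨⟨e.1, fun i hi => ?_⟩, rfl⟩
        rcases hi.eq_or_lt with rfl | hi
        · exact h
        · exact e.2 i hi
    rw [this]
    exact isClosed_singleton.preimage ((MilnorE.continuous_t n).comp continuous_subtype_val)

variable [Group G]

/-- The right translation `⟨tᵢ gᵢ⟩ a = ⟨tᵢ (gᵢ a)⟩`. -/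
def EG.translate {n : ℕ} (e : EG G n) (a : G) : EG G n :=
  ⟨⟨e.1.t, e.1.nonneg, e.1.sum_eq_one, fun i h => e.1.g i h * a⟩, e.2⟩

lemma EG.translate_one {n : ℕ} (e : EG G n) : e.translate 1 = e := by
  simp [EG.translate]

lemma EG.translate_translate {n : ℕ} (e : EG G n) (a b : G) :
    (e.translate a).translate b = e.translate (a * b) := by
  simp [EG.translate, mul_assoc]

variable (G) in
/-- Points of `EG(n)` are equivalent when they are translates of each other. -/
def BG.setoid (n : ℕ) : Setoid (EG G n) where
  r e e' := ∃ a : G, e' = e.translate a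
  iseqv :=
    { refl := fun e => ⟨1, e.translate_one.symm⟩
      symm := by
        rintro e _ ⟨a, rfl⟩
        exact ⟨a⁻¹, by rw [EG.translate_translate, mul_inv_cancel, EG.translate_one]⟩
      trans := by
        rintro e _ _ ⟨a, rfl⟩ ⟨b, rfl⟩
        exact ⟨a * b, by rw [EG.translate_translate]⟩ }

variable (G) in
/-- The approximation `BG(n) = EG(n) / G` of the classifying space. -/
abbrev BG (n : ℕ) := Quotient (BG.setoid G n)

variable {X : Type*} [TopologicalSpace X]

/-- The relation `(e a, x) ∼ (e, φ(a) x)` on `EG(n) × X`. -/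
def homotopyQuotient.setoid (φ : G →* (X ≃ₜ X)) (n : ℕ) : Setoid (EG G n × X) where
  r p q := ∃ a : G, q.1 = p.1.translate a ∧ p.2 = φ a q.2
  iseqv :=
    { refl := fun p => ⟨1, p.1.translate_one.symm, by rw [map_one]; rfl⟩
      symm := by
        rintro ⟨e, x⟩ ⟨e', y⟩ ⟨a, h₁, h₂⟩
        change e' = e.translate a at h₁
        change x = φ a y at h₂
        subst h₁ h₂
        refine ⟨a⁻¹, ?_, ?_⟩
        · change e = (e.translate a).translate a⁻¹
          rw [EG.translate_translate, mul_inv_cancel, EG.translate_one]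
        · change y = (φ a⁻¹ * φ a) y
          rw [← map_mul, inv_mul_cancel, map_one]
          rfl
      trans := by
        rintro ⟨e, x⟩ ⟨e', y⟩ ⟨e'', z⟩ ⟨a, h₁, h₂⟩ ⟨b, h₃, h₄⟩
        change e' = e.translate a at h₁
        change x = φ a y at h₂
        change e'' = e'.translate b at h₃
        change y = φ b z at h₄
        subst h₁ h₂ h₃ h₄
        refine ⟨a * b, ?_, ?_⟩
        · exact EG.translate_translate e a b
        · change (φ a * φ b) z = _
          rw [← map_mul] }

/-- The homotopy quotient `X_φ(n) = EG(n) ×_φ X`. -/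
abbrev homotopyQuotient (φ : G →* (X ≃ₜ X)) (n : ℕ) := Quotient (homotopyQuotient.setoid φ n)

/-- The projection `X_φ(n) → BG(n)`. -/
def homotopyQuotient.proj (φ : G →* (X ≃ₜ X)) (n : ℕ) : homotopyQuotient φ n → BG G n :=
  Quotient.map Prod.fst fun _ _ ⟨a, h, _⟩ => ⟨a, h⟩

lemma homotopyQuotient.continuous_proj (φ : G →* (X ≃ₜ X)) (n : ℕ) :
    Continuous (homotopyQuotient.proj φ n) :=
  Continuous.quotient_map' continuous_fst _

/-- The map `BG(n) → BG(n + 1)`. -/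
def BG.incl (n : ℕ) : BG G n → BG G (n + 1) :=
  Quotient.map EG.incl (by rintro e _ ⟨a, rfl⟩; exact ⟨a, rfl⟩)

lemma BG.continuous_incl (n : ℕ) : Continuous (BG.incl n : BG G n → BG G (n + 1)) :=
  Continuous.quotient_map' (EG.isClosedEmbedding_incl n).continuous _

lemma BG.injective_incl (n : ℕ) : Function.Injective (BG.incl n : BG G n → BG G (n + 1)) := by
  rintro ⟨e⟩ ⟨e'⟩ h
  obtain ⟨a, ha⟩ := Quotient.exact h
  exact Quotient.sound ⟨a, (EG.isClosedEmbedding_incl n).injective ha⟩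

/-- The map `X_φ(n) → X_φ(n + 1)`. -/
def homotopyQuotient.incl (φ : G →* (X ≃ₜ X)) (n : ℕ) :
    homotopyQuotient φ n → homotopyQuotient φ (n + 1) :=
  Quotient.map (Prod.map EG.incl id) (by rintro ⟨e, x⟩ ⟨_, y⟩ ⟨a, rfl, h⟩; exact ⟨a, rfl, h⟩)

lemma homotopyQuotient.isClosedEmbedding_incl (φ : G →* (X ≃ₜ X)) (n : ℕ) :
    Topology.IsClosedEmbedding (homotopyQuotient.incl φ n) := by
  have hemb : Topology.IsClosedEmbedding
      (Prod.map EG.incl id : EG G n × X → EG G (n + 1) × X) :=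
    (EG.isClosedEmbedding_incl n).prodMap .id
  refine .of_continuous_injective_isClosedMap (Continuous.quotient_map' hemb.continuous _) ?_ ?_
  · rintro ⟨e, x⟩ ⟨e', x'⟩ h
    obtain ⟨a, ha, hx⟩ := Quotient.exact h
    exact Quotient.sound ⟨a, (EG.isClosedEmbedding_incl n).injective ha, hx⟩
  · intro C hC
    have hq : Topology.IsQuotientMap
        (Quotient.mk (homotopyQuotient.setoid φ (n + 1))) := isQuotientMap_quotient_mk'
    rw [← hq.isClosed_preimage]
    have : Quotient.mk (homotopyQuotient.setoid φ (n + 1)) ⁻¹' (homotopyQuotient.incl φ n '' C) =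
        Prod.map EG.incl id '' (Quotient.mk (homotopyQuotient.setoid φ n) ⁻¹' C) := by
      ext ⟨e, x⟩
      constructor
      · rintro ⟨⟨e₀, x₀⟩, hC₀, h⟩
        obtain ⟨a, ha, hx⟩ := Quotient.exact h
        refine ⟨(e₀.translate a, x), ?_, Prod.ext ha.symm rfl⟩
        have : (Quotient.mk (homotopyQuotient.setoid φ n) (e₀.translate a, x)) =
            Quotient.mk _ (e₀, x₀) := Quotient.sound (Setoid.symm' _ ⟨a, rfl, hx⟩)
        change Quotient.mk _ _ ∈ C
        rw [this]
        exact hC₀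
      · rintro ⟨⟨e₀, x₀⟩, hC₀, h⟩
        exact ⟨Quotient.mk _ (e₀, x₀), hC₀, congrArg (Quotient.mk _) h⟩
    rw [this]
    exact hemb.isClosedMap _ (hC.preimage continuous_quotient_mk')

end Milnor

section EquivariantCohomology

/-- The field of complex numbers, in the universe `u`. -/
abbrev CC : Type u := ULift.{u} ℂ

variable {G X : Type u} [TopologicalSpace G] [Group G] [TopologicalSpace X]

/-- The projection `π_n : X_φ(n) → BG(n)` in the category of topological spaces. -/
def bundle (φ : G →* (X ≃ₜ X)) (n : ℕ) :
    TopCat.of (homotopyQuotient φ n) ⟶ TopCat.of (BG G n) :=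
  TopCat.ofHom ⟨homotopyQuotient.proj φ n, homotopyQuotient.continuous_proj φ n⟩

/-- `Hⁱ(BG(n); R(π_n)_! ℂ)`. -/
def stageCohomology (φ : G →* (X ≃ₜ X)) (n : ℕ) (i : ℤ) : ModuleCat.{u} CC.{u} :=
  shriekCohomology CC.{u} (bundle φ n) i

/-- The restriction map `Hⁱ(BG(n + 1); R(π_{n + 1})_! ℂ) ⟶ Hⁱ(BG(n); R(π_n)_! ℂ)`. -/
def stageRestriction (φ : G →* (X ≃ₜ X)) (n : ℕ) (i : ℤ) :
    stageCohomology φ (n + 1) i ⟶ stageCohomology φ n i :=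
  shriekCohomologyMap CC.{u} (bundle φ (n + 1)) (bundle φ n)
    (TopCat.ofHom ⟨homotopyQuotient.incl φ n,
      (homotopyQuotient.isClosedEmbedding_incl φ n).continuous⟩)
    (TopCat.ofHom ⟨BG.incl n, BG.continuous_incl n⟩)
    (by ext ⟨e, x⟩; rfl)
    (homotopyQuotient.isClosedEmbedding_incl φ n).isProperMap
    (BG.injective_incl n) i

/-- The equivariant cohomology with compact supports `Hⁱ_{φ,c}(X; ℂ)` in degree `i`, as a module
over the copy of `ℂ` in the universe `u`: the compatible families of classes in
`Hⁱ(BG(n); R(π_n)_! ℂ)`, `n = 1, 2, …`. -/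
def equivariantCompactFamilies (φ : G →* (X ≃ₜ X)) (i : ℤ) :
    Submodule CC.{u} (∀ n : ℕ, stageCohomology φ (n + 1) i) where
  carrier := {s | ∀ n, (stageRestriction φ (n + 1) i).hom (s (n + 1)) = s n}
  zero_mem' _ := map_zero _
  add_mem' hs ht n := (map_add _ _ _).trans (congrArg₂ _ (hs n) (ht n))
  smul_mem' c _ hs n := (map_smul _ c _).trans (congrArg _ (hs n))

/-- The equivariant cohomology with compact supports `Hⁱ_{φ,c}(X; ℂ)` in degree `i`. -/
def EquivariantCompactCohomology (φ : G →* (X ≃ₜ X)) (i : ℤ) : Type u :=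
  equivariantCompactFamilies φ i

instance (φ : G →* (X ≃ₜ X)) (i : ℤ) : AddCommGroup (EquivariantCompactCohomology φ i) :=
  inferInstanceAs (AddCommGroup (equivariantCompactFamilies φ i))

instance (φ : G →* (X ≃ₜ X)) (i : ℤ) : Module CC.{u} (EquivariantCompactCohomology φ i) :=
  inferInstanceAs (Module CC.{u} (equivariantCompactFamilies φ i))

instance (φ : G →* (X ≃ₜ X)) (i : ℤ) : Module ℂ (EquivariantCompactCohomology φ i) :=
  Module.compHom _ (ULift.ringEquiv.symm : ℂ ≃+* CC.{u}).toRingHom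

/-- The compact-open topology on the homeomorphism group of `X`. -/
instance : TopologicalSpace (X ≃ₜ X) :=
  TopologicalSpace.induced (fun h => (h : C(X, X))) inferInstance

/-- Two continuous homomorphisms are homotopic through a family of group homomorphisms. -/
def HomotopicThroughHoms {ℋ : Subgroup (X ≃ₜ X)} (φ φ' : G →ₜ* ℋ) : Prop :=
  ContinuousMap.HomotopicWith φ.toContinuousMap φ'.toContinuousMap
    (fun f => ∀ a b : G, f (a * b) = f a * f b)

end EquivariantCohomology

end DefAct

end

/-! A homotopy through homomorphisms is a jointly continuous family of actions `A s`, `s ∈ [0,1]`,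
joining `φ` to `φ'`. It suffices to turn it into homeomorphisms `X_φ(n) ≃ X_φ'(n)` over `BG(n)` that
commute with the inclusions `n ⊂ n + 1`, because `Hⁱ(BG(n); R(π_n)_! ℂ)` and its restriction maps
are functorial in commutative squares.

Such a homeomorphism comes from homeomorphisms `T_e` of `X`, with `T_e x` and its inverse jointly
continuous in `(e, x)`, satisfying `φ'(a) T_{ea} = T_e φ(a)`. Where `t_k > 0`, the element
`A_v(g_k)⁻¹ A_u(g_k)` satisfies this identity with `A_u`, `A_v` for `φ`, `φ'`; but `g_k` is lost as
`t_k → 0`. Hence `[0,1]` is subdivided by times `τ_0 ≤ τ_1 ≤ ⋯` depending on `e`: the interval from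
`τ_k` to `τ_{k+1}` is crossed with the help of `g_k`, and it is degenerate as soon as `2 t_k ≤ ∑
t_i²`. `T_e` is the product of these comparisons. The points to check are that the times reach `1`
(`EG.time_eq_one`), equivariance (`EG.transport_translate`) and continuity (`EG.continuous_step`).
The formula does not involve `n` except through the number of factors, and the extra factors are
trivial, whence compatibility with the inclusions.

On the sheaf side, the restriction map is assembled from canonical morphisms of derived functors,
some of them inverted. A natural transformation out of a right derived functor is determined by its
composite with the unit, so each required identity can be tested on complexes, where it holds degree
by degree and finally says that restriction of sections is transitive. This gives
`derivedRestriction_comp` and `derivedRestriction_id`; homeomorphisms of bundles then induce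
isomorphisms at every stage that commute with the maps of the inverse system. -/

noncomputable section

namespace DefAct

open CategoryTheory TopologicalSpace Limits Opposite

/-! ### Times on the Milnor join and the transport they define. -/

section Transport

open unitInterval

variable {G : Type*}

/-- The sum of the squares of the barycentric coordinates. -/
def MilnorE.sqSum (e : MilnorE G) : ℝ := e.t.sum fun _ r => r ^ 2

/-- A rescaling of the `k`-th barycentric coordinate which vanishes for `tₖ ≤ ∑ tᵢ² / 2`. -/
def MilnorE.weight (k : ℕ) (e : MilnorE G) : ℝ := max 0 (2 * e.t k / e.sqSum - 1)

/-- The partial sums of the weights, truncated at `1`. -/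
def MilnorE.time (k : ℕ) (e : MilnorE G) : I :=
  Set.projIcc 0 1 zero_le_one (∑ j ∈ Finset.range k, e.weight j)

lemma EG.sum_range [TopologicalSpace G] {n : ℕ} (e : EG G n) (f : ℕ → ℝ → ℝ) (hf : ∀ i, f i 0 = 0) :
    e.1.t.sum f = ∑ i ∈ Finset.range n, f i (e.1.t i) := by
  refine Finsupp.sum_of_support_subset _ (fun i hi => ?_) _ fun i _ => hf i
  by_contra h
  exact Finsupp.mem_support_iff.mp hi (e.2 i (by simpa using h))

lemma EG.sum_t [TopologicalSpace G] {n : ℕ} (e : EG G n) : ∑ i ∈ Finset.range n, e.1.t i = 1 := by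
  rw [← e.1.sum_eq_one, e.sum_range _ fun _ => rfl]

lemma EG.sqSum_eq [TopologicalSpace G] {n : ℕ} (e : EG G n) :
    e.1.sqSum = ∑ i ∈ Finset.range n, e.1.t i ^ 2 :=
  e.sum_range _ fun _ => by norm_num

lemma EG.sqSum_pos [TopologicalSpace G] {n : ℕ} (e : EG G n) : 0 < e.1.sqSum := by
  rw [e.sqSum_eq]
  refine (Finset.sum_nonneg fun i _ => sq_nonneg _).lt_of_ne fun h => ?_
  have h0 := (Finset.sum_eq_zero_iff_of_nonneg fun i _ => sq_nonneg (e.1.t i)).mp h.symm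
  have := e.sum_t
  rw [Finset.sum_eq_zero fun i hi => by simpa using h0 i hi] at this
  exact zero_ne_one this

lemma EG.continuous_sqSum [TopologicalSpace G] {n : ℕ} :
    Continuous fun e : EG G n => e.1.sqSum := by
  simp only [EG.sqSum_eq]
  exact continuous_finsetSum _ fun i _ =>
    ((MilnorE.continuous_t i).comp continuous_subtype_val).pow 2

lemma EG.continuous_weight [TopologicalSpace G] {n : ℕ} (k : ℕ) :
    Continuous fun e : EG G n => e.1.weight k := by
  unfold MilnorE.weight
  exact continuous_const.max ((((continuous_const.mul ((MilnorE.continuous_t k).comp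
    continuous_subtype_val)).div EG.continuous_sqSum fun e : EG G n => e.sqSum_pos.ne')).sub
    continuous_const)

lemma EG.continuous_time [TopologicalSpace G] {n : ℕ} (k : ℕ) :
    Continuous fun e : EG G n => e.1.time k :=
  continuous_projIcc.comp (continuous_finsetSum _ fun i _ => EG.continuous_weight i)

lemma EG.weight_eq_zero [TopologicalSpace G] {n : ℕ} (e : EG G n) {k : ℕ}
    (h : 2 * e.1.t k ≤ e.1.sqSum) : e.1.weight k = 0 := by
  refine max_eq_left ?_
  rw [sub_nonpos]
  exact (div_le_one e.sqSum_pos).mpr h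

/-- The clock stands still near the locus `t_k = 0` where `g_k` disappears: `∑ t_i²` is positive, so
the condition holds on a neighbourhood of that locus. All later continuity arguments rest on this.
-/
lemma EG.time_succ_eq [TopologicalSpace G] {n : ℕ} (e : EG G n) {k : ℕ}
    (h : 2 * e.1.t k ≤ e.1.sqSum) : e.1.time (k + 1) = e.1.time k := by
  rw [MilnorE.time, Finset.sum_range_succ, e.weight_eq_zero h, add_zero, MilnorE.time]

lemma MilnorE.time_zero (e : MilnorE G) : e.time 0 = 0 := by
  simp only [MilnorE.time, Finset.range_zero, Finset.sum_empty]
  exact Set.projIcc_left (zero_le_one' ℝ)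

/-- The average of `2 t_i / ∑ t_j² - 1` with respect to the probability weights `t_i` is `2 - 1 =
1`. Replacing each term by its positive part, and each factor `t_i ≤ 1` by `1`, only increases the
sum; hence the weights add up to at least `1` and the truncation gives exactly `1`. No normalisation
of the weights is needed. -/
lemma EG.time_eq_one [TopologicalSpace G] {n : ℕ} (e : EG G n) : e.1.time n = 1 := by
  refine Set.projIcc_of_right_le zero_le_one (?_ : (1 : ℝ) ≤ _)
  have h1 : ∑ i ∈ Finset.range n, e.1.t i * (2 * e.1.t i / e.1.sqSum - 1) = 1 := by
    have : ∀ i, e.1.t i * (2 * e.1.t i / e.1.sqSum - 1) =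
        2 / e.1.sqSum * e.1.t i ^ 2 - e.1.t i := fun i => by ring
    simp only [this]
    rw [Finset.sum_sub_distrib, ← Finset.mul_sum, ← e.sqSum_eq, e.sum_t,
      div_mul_cancel₀ _ e.sqSum_pos.ne']
    norm_num
  rw [← h1]
  refine Finset.sum_le_sum fun i hi => ?_
  have hle : e.1.t i ≤ 1 := by
    rw [← e.sum_t]
    exact Finset.single_le_sum (f := fun i => e.1.t i) (fun j _ => e.1.nonneg j) hi
  calc e.1.t i * (2 * e.1.t i / e.1.sqSum - 1)
      ≤ e.1.t i * e.1.weight i :=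
        mul_le_mul_of_nonneg_left (le_max_right _ _) (e.1.nonneg i)
    _ ≤ 1 * e.1.weight i := mul_le_mul_of_nonneg_right hle (le_max_left _ _)
    _ = e.1.weight i := one_mul _

variable {X : Type*} [TopologicalSpace X] (A : I → G → (X ≃ₜ X))

open Classical in
/-- The comparison of the actions with parameters `u` and `v` in the `k`-th trivialisation. -/
def MilnorE.step (u v : I) (k : ℕ) (e : MilnorE G) : X ≃ₜ X :=
  if h : 0 < e.t k then (A v (e.g k h))⁻¹ * A u (e.g k h) else 1

/-- The composite of the first `k` comparisons along the partial sums of the weights. -/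
def MilnorE.transport (e : MilnorE G) : ℕ → (X ≃ₜ X)
  | 0 => 1
  | k + 1 => e.step A (e.time k) (e.time (k + 1)) k * e.transport k

/-- Inverting a comparison exchanges its two parameters, so the inverse transport is again a product
of comparisons and needs no separate continuity theory. -/
lemma MilnorE.step_inv (u v : I) (k : ℕ) (e : MilnorE G) :
    (e.step A u v k)⁻¹ = e.step A v u k := by
  unfold MilnorE.step
  split_ifs <;> simp

lemma MilnorE.step_self (u : I) (k : ℕ) (e : MilnorE G) : e.step A u u k = 1 := by
  unfold MilnorE.step
  split_ifs <;> simp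

/-- On `EG(n)` the coordinate `t_n` vanishes, so the additional factor takes its default value `1`.
This is what makes the homeomorphisms compatible with `EG(n) ⊂ EG(n + 1)`. -/
lemma EG.transport_incl [TopologicalSpace G] {n : ℕ} (e : EG G n) :
    e.1.transport A (n + 1) = e.1.transport A n := by
  rw [MilnorE.transport, MilnorE.step, dif_neg (by simp [e.2 n le_rfl]), one_mul]

variable [Group G] [TopologicalSpace G]

lemma EG.time_translate {n : ℕ} (e : EG G n) (a : G) (k : ℕ) :
    (e.translate a).1.time k = e.1.time k := rfl

/-- Each factor intertwines two consecutive actions: `A_v(a) A_v(ga)⁻¹ A_u(ga) = A_v(g)⁻¹ A_u(g)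
A_u(a)`. The product telescopes from time `0` to time `τ_k`. -/
lemma EG.transport_translate (hA : ∀ s a b, A s (a * b) = A s a * A s b) {n : ℕ}
    (e : EG G n) (a : G) (k : ℕ) :
    A (e.1.time k) a * (e.translate a).1.transport A k = e.1.transport A k * A 0 a := by
  induction k with
  | zero => simp [MilnorE.transport, MilnorE.time_zero]
  | succ k ih =>
    rw [MilnorE.transport, MilnorE.transport, mul_assoc, ← ih, ← mul_assoc, ← mul_assoc]
    congr 1
    rw [EG.time_translate, EG.time_translate]
    by_cases h : 0 < e.1.t k
    · have h' : 0 < (e.translate a).1.t k := h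
      rw [MilnorE.step, MilnorE.step, dif_pos h, dif_pos h']
      change _ * ((A _ (e.1.g k h * a))⁻¹ * A _ (e.1.g k h * a)) = _
      rw [hA, hA]
      group
    · have h' : ¬ 0 < (e.translate a).1.t k := h
      -- Without a group coordinate both factors are `1`, so equality requires that the time does
      -- not move either.
      rw [MilnorE.step, MilnorE.step, dif_neg h, dif_neg h', one_mul, mul_one, e.time_succ_eq]
      have : e.1.t k = 0 := le_antisymm (not_lt.mp h) (e.1.nonneg k)
      rw [this, mul_zero]
      exact e.sqSum_pos.le

/-! ### Joint continuity of the transport and of its inverse. -/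

variable {A}

lemma EG.continuousOn_step [ContinuousInv G]
    (hc : Continuous fun p : (I × G) × X => A p.1.1 p.1.2 p.2)
    (hinv : ∀ s a, (A s a)⁻¹ = A s a⁻¹) {n : ℕ} {u v : EG G n → I} (hu : Continuous u)
    (hv : Continuous v) (k : ℕ) :
    ContinuousOn (fun p : EG G n × X => p.1.1.step A (u p.1) (v p.1) k p.2)
      {p | 0 < p.1.1.t k} := by
  rw [continuousOn_iff_continuous_domRestrict]
  let S : Set (EG G n × X) := {p | 0 < p.1.1.t k}
  have hg : Continuous fun p : S => p.1.1.1.g k p.2 := by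
    -- Preimages under `g_k` are traces of the subbasic open sets of the topology on `MilnorE G`.
    refine continuous_def.mpr fun V hV => ?_
    have ho : IsOpen {e : MilnorE G | ∃ h : 0 < e.t k, e.g k h ∈ V} :=
      TopologicalSpace.isOpen_generateFrom_of_mem (Or.inr ⟨k, V, hV, rfl⟩)
    convert ho.preimage (continuous_subtype_val.comp (continuous_fst.comp
      (continuous_subtype_val (p := fun p => p ∈ S)))) using 1
    ext p
    exact ⟨fun h => ⟨p.2, h⟩, fun ⟨_, h⟩ => h⟩
  have h1 : Continuous fun p : S => p.1.1 := continuous_fst.comp continuous_subtype_val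
  have h2 : Continuous fun p : S => p.1.2 := continuous_snd.comp continuous_subtype_val
  have h3 := hc.comp (((hu.comp h1).prodMk hg).prodMk h2)
  have h4 := hc.comp (((hv.comp h1).prodMk hg.inv).prodMk h3)
  refine h4.congr fun p => ?_
  simp only [Set.domRestrict_apply, MilnorE.step]
  -- Writing `(A_v g)⁻¹` as `A_v g⁻¹` reduces to inversion in `G`; continuity of inversion in the
  -- homeomorphism group is not needed.
  rw [dif_pos (show 0 < p.1.1.1.t k from p.2), hinv]
  rfl

/-- The open sets `t_k > 0` and `2 t_k < ∑ t_i²` cover `EG(n)`. On the first the comparison is given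
by a continuous formula in `g_k`; on the second `u = v` and the comparison is the identity. -/
lemma EG.continuous_step [ContinuousInv G]
    (hc : Continuous fun p : (I × G) × X => A p.1.1 p.1.2 p.2)
    (hinv : ∀ s a, (A s a)⁻¹ = A s a⁻¹) {n : ℕ} {u v : EG G n → I} (hu : Continuous u)
    (hv : Continuous v) (k : ℕ) (huv : ∀ e : EG G n, 2 * e.1.t k ≤ e.1.sqSum → u e = v e) :
    Continuous (fun p : EG G n × X => p.1.1.step A (u p.1) (v p.1) k p.2) := by
  have ht : Continuous fun p : EG G n × X => p.1.1.t k :=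
    (MilnorE.continuous_t k).comp (continuous_subtype_val.comp continuous_fst)
  have hq : Continuous fun p : EG G n × X => p.1.1.sqSum :=
    EG.continuous_sqSum.comp continuous_fst
  refine continuous_iff_continuousAt.mpr fun p => ?_
  by_cases h : 0 < p.1.1.t k
  · exact (EG.continuousOn_step hc hinv hu hv k).continuousAt
      ((isOpen_lt continuous_const ht).mem_nhds h)
  · have hp : 2 * p.1.1.t k < p.1.1.sqSum := by linarith [p.1.sqSum_pos]
    refine continuousAt_snd.congr ?_
    filter_upwards [(isOpen_lt (continuous_const.mul ht) hq).mem_nhds hp] with x hx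
    rw [huv x.1 (le_of_lt hx), MilnorE.step_self]
    rfl

lemma EG.continuous_transport [ContinuousInv G]
    (hc : Continuous fun p : (I × G) × X => A p.1.1 p.1.2 p.2)
    (hinv : ∀ s a, (A s a)⁻¹ = A s a⁻¹) {n : ℕ} (k : ℕ) :
    Continuous (fun p : EG G n × X => p.1.1.transport A k p.2) := by
  induction k with
  | zero => exact continuous_snd
  | succ k ih =>
    have h := EG.continuous_step (n := n) hc hinv (EG.continuous_time k)
      (EG.continuous_time (k + 1)) k fun e h => (e.time_succ_eq h).symm
    exact h.comp (continuous_fst.prodMk ih)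

/-- The inverse product runs through the factors in the opposite order with time parameters
exchanged, so the newest factor is applied first and the induction hypothesis afterwards. -/
lemma EG.continuous_transport_inv [ContinuousInv G]
    (hc : Continuous fun p : (I × G) × X => A p.1.1 p.1.2 p.2)
    (hinv : ∀ s a, (A s a)⁻¹ = A s a⁻¹) {n : ℕ} (k : ℕ) :
    Continuous (fun p : EG G n × X => (p.1.1.transport A k)⁻¹ p.2) := by
  induction k with
  | zero => exact continuous_snd
  | succ k ih =>
    have h := EG.continuous_step (n := n) hc hinv (EG.continuous_time (k + 1))
      (EG.continuous_time k) k fun e h => e.time_succ_eq h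
    refine (ih.comp (continuous_fst.prodMk h)).congr fun p => ?_
    simp only [Function.comp_apply, MilnorE.transport, mul_inv_rev, MilnorE.step_inv]
    rfl

end Transport

/-! ### The homeomorphisms `X_φ(n) ≃ X_φ'(n)` over `BG(n)`. -/

section BundleIso

open unitInterval

variable {G X : Type*} [TopologicalSpace G] [Group G] [TopologicalSpace X]

/-- The homeomorphism `X_φ(n) ≃ X_φ'(n)` over `BG(n)` defined by the transport along a family of
actions `A` connecting `φ` to `φ'`. -/
def homotopyQuotient.homeomorph [ContinuousInv G] (φ φ' : G →* (X ≃ₜ X)) (A : I → G →* (X ≃ₜ X))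
    (hc : Continuous fun p : (I × G) × X => A p.1.1 p.1.2 p.2) (h₀ : A 0 = φ) (h₁ : A 1 = φ')
    (n : ℕ) : homotopyQuotient φ n ≃ₜ homotopyQuotient φ' n where
  toFun := Quotient.map (fun p => (p.1, p.1.1.transport (fun s => A s) n p.2)) (by
    rintro ⟨e, x⟩ ⟨_, y⟩ ⟨a, rfl, h⟩
    refine ⟨a, rfl, ?_⟩
    have := EG.transport_translate (fun s => A s) (fun s => map_mul (A s)) e a n
    -- After `n` factors the time is `1`, so the intertwining relation is between `φ` and `φ'`
    -- themselves, which is the compatibility with the two quotient relations.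
    rw [e.time_eq_one, h₀, h₁] at this
    change x = φ a y at h
    subst h
    exact (DFunLike.congr_fun this y).symm)
  invFun := Quotient.map (fun p => (p.1, (p.1.1.transport (fun s => A s) n)⁻¹ p.2)) (by
    rintro ⟨e, x⟩ ⟨_, y⟩ ⟨a, rfl, h⟩
    refine ⟨a, rfl, ?_⟩
    have := EG.transport_translate (fun s => A s) (fun s => map_mul (A s)) e a n
    rw [e.time_eq_one, h₀, h₁, ← eq_inv_mul_iff_mul_eq] at this
    change x = φ' a y at h
    subst h
    have h2 : (e.1.transport (fun s => A s) n)⁻¹ * φ' a =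
        φ a * ((e.translate a).1.transport (fun s => A s) n)⁻¹ := by
      rw [this]
      group
    exact DFunLike.congr_fun h2 y)
  left_inv := by
    rintro ⟨e, x⟩
    exact congrArg (Quotient.mk _)
      (Prod.ext rfl ((e.1.transport (fun s => A s) n).symm_apply_apply x))
  right_inv := by
    rintro ⟨e, x⟩
    exact congrArg (Quotient.mk _)
      (Prod.ext rfl ((e.1.transport (fun s => A s) n).apply_symm_apply x))
  continuous_toFun := Continuous.quotient_map' (continuous_fst.prodMk
    (EG.continuous_transport hc (fun s a => (map_inv (A s) a).symm) n)) _
  continuous_invFun := Continuous.quotient_map' (continuous_fst.prodMk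
    (EG.continuous_transport_inv hc (fun s a => (map_inv (A s) a).symm) n)) _

lemma homotopyQuotient.proj_homeomorph [ContinuousInv G] (φ φ' : G →* (X ≃ₜ X))
    (A : I → G →* (X ≃ₜ X))
    (hc : Continuous fun p : (I × G) × X => A p.1.1 p.1.2 p.2) (h₀ : A 0 = φ) (h₁ : A 1 = φ')
    (n : ℕ) (x : homotopyQuotient φ n) :
    homotopyQuotient.proj φ' n (homotopyQuotient.homeomorph φ φ' A hc h₀ h₁ n x) =
      homotopyQuotient.proj φ n x := by
  obtain ⟨e, x⟩ := x
  rfl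

lemma homotopyQuotient.homeomorph_incl [ContinuousInv G] (φ φ' : G →* (X ≃ₜ X))
    (A : I → G →* (X ≃ₜ X))
    (hc : Continuous fun p : (I × G) × X => A p.1.1 p.1.2 p.2) (h₀ : A 0 = φ) (h₁ : A 1 = φ')
    (n : ℕ) (x : homotopyQuotient φ n) :
    homotopyQuotient.homeomorph φ φ' A hc h₀ h₁ (n + 1) (homotopyQuotient.incl φ n x) =
      homotopyQuotient.incl φ' n (homotopyQuotient.homeomorph φ φ' A hc h₀ h₁ n x) := by
  obtain ⟨e, x⟩ := x
  exact congrArg (Quotient.mk _) (Prod.ext rfl (DFunLike.congr_fun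
    (EG.transport_incl (fun s => A s) e) x))

/-- A homotopy through homomorphisms, as a jointly continuous family of actions. -/
lemma HomotopicThroughHoms.exists_family {G X : Type u} [TopologicalSpace G] [Group G]
    [TopologicalSpace X] [LocallyCompactSpace X] {ℋ : Subgroup (X ≃ₜ X)} {φ φ' : G →ₜ* ℋ}
    (h : HomotopicThroughHoms φ φ') :
    ∃ A : I → G →* (X ≃ₜ X), (Continuous fun p : (I × G) × X => A p.1.1 p.1.2 p.2) ∧
      A 0 = ℋ.subtype.comp φ.toMonoidHom ∧ A 1 = ℋ.subtype.comp φ'.toMonoidHom := by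
  obtain ⟨F⟩ := h
  refine ⟨fun s => ℋ.subtype.comp (MonoidHom.mk' (fun g => F (s, g)) (F.prop s)), ?_, ?_, ?_⟩
  · have h1 : Continuous fun p : I × G => ((F p : X ≃ₜ X) : C(X, X)) :=
      continuous_induced_dom.comp (continuous_subtype_val.comp F.continuous)
    -- Local compactness of `X` enters here: it makes evaluation `C(X, X) × X → X` jointly
    -- continuous.
    exact (h1.comp continuous_fst).eval continuous_snd
  · ext g x
    exact congrArg (fun k : ℋ => k.1 x) (F.apply_zero g)
  · ext g x
    exact congrArg (fun k : ℋ => k.1 x) (F.apply_one g)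

end BundleIso

/-! ### Coherence of the canonical morphisms between derived functors. -/

section DerivedFunctoriality

open DerivedCategory.Plus (Qh)

variable {C D E : Type*} [Category* C] [Category* D] [Category* E]
  [Abelian C] [Abelian D] [Abelian E]

/-! ### Identities between maps of complexes, checked degree by degree. -/

section HomotopyPlus

/-- The morphism `S(P(K)) ⟶ J(S'(K))` of complexes induced by `τ : P ⋙ S ⟶ S' ⋙ J`. -/
def squareMap {D' : Type*} [Category* D'] [Abelian D'] {P : C ⥤ D} {S : D ⥤ E} {S' : C ⥤ D'}
    {J : D' ⥤ E} [P.Additive] [S.Additive] [S'.Additive] [J.Additive] (τ : P ⋙ S ⟶ S' ⋙ J)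
    (K : HomotopyCategory.Plus C) :
    S.mapHomotopyCategoryPlus.obj (P.mapHomotopyCategoryPlus.obj K) ⟶
      J.mapHomotopyCategoryPlus.obj (S'.mapHomotopyCategoryPlus.obj K) :=
  (homotopyPlusMap τ).app K

/-- The morphism `H(K) ⟶ G(F(K))` of complexes induced by `τ : H ⟶ F ⋙ G`. -/
def splitMap {F : C ⥤ D} {G : D ⥤ E} {H : C ⥤ E} [F.Additive] [G.Additive] [H.Additive]
    (τ : H ⟶ F ⋙ G) (K : HomotopyCategory.Plus C) :
    H.mapHomotopyCategoryPlus.obj K ⟶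
      G.mapHomotopyCategoryPlus.obj (F.mapHomotopyCategoryPlus.obj K) :=
  (homotopyPlusMap τ).app K

/-- The morphism `F(K) ⟶ K` of complexes induced by `τ : F ⟶ 𝟭`. -/
def collapseMap {F : C ⥤ C} [F.Additive] (τ : F ⟶ 𝟭 C) (K : HomotopyCategory.Plus C) :
    F.mapHomotopyCategoryPlus.obj K ⟶ K :=
  (homotopyPlusMap τ).app K

lemma collapseMap_naturality {F : C ⥤ C} [F.Additive] (τ : F ⟶ 𝟭 C)
    {K L : HomotopyCategory.Plus C} (f : K ⟶ L) :
    F.mapHomotopyCategoryPlus.map f ≫ collapseMap τ L = collapseMap τ K ≫ f := by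
  obtain ⟨f⟩ := f
  -- A morphism in the homotopy category has to be represented by a chain map before it can be
  -- inspected in each degree.
  obtain ⟨f, rfl⟩ := (HomotopyCategory.quotient _ _).map_surjective f
  ext
  change (HomotopyCategory.quotient _ _).map _ = (HomotopyCategory.quotient _ _).map _
  congr 1
  ext i
  exact τ.naturality (f.f i)

lemma splitMap_assoc {M : Type*} [Category* M] [Abelian M] {F : C ⥤ D} {G : D ⥤ E}
    {H : E ⥤ M} {FG : C ⥤ E} {GH : D ⥤ M} {T : C ⥤ M}
    [F.Additive] [G.Additive] [H.Additive] [FG.Additive] [GH.Additive] [T.Additive]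
    (a : FG ⟶ F ⋙ G) (b : GH ⟶ G ⋙ H) (c : T ⟶ FG ⋙ H) (d : T ⟶ F ⋙ GH)
    (h : ∀ A, c.app A ≫ H.map (a.app A) = d.app A ≫ b.app (F.obj A))
    (K : HomotopyCategory.Plus C) :
    splitMap c K ≫ H.mapHomotopyCategoryPlus.map (splitMap a K) =
      splitMap d K ≫ splitMap b (F.mapHomotopyCategoryPlus.obj K) := by
  ext
  change (HomotopyCategory.quotient _ _).map _ = (HomotopyCategory.quotient _ _).map _
  congr 1
  ext i
  exact h (K.obj.as.X i)

/-- Pasting of the squares of complexes induced by `τ` and `τ'`. -/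
lemma squareMap_paste {C' C'' D' D'' : Type*} [Category* C'] [Abelian C'] [Category* C'']
    [Abelian C''] [Category* D'] [Abelian D'] [Category* D''] [Abelian D'']
    {P' : C'' ⥤ C'} {P : C' ⥤ C} {PP : C'' ⥤ C} {S : C ⥤ D} {S' : C' ⥤ D'} {S'' : C'' ⥤ D''}
    {J' : D'' ⥤ D'} {J : D' ⥤ D} {JJ : D'' ⥤ D}
    [P'.Additive] [P.Additive] [PP.Additive] [S.Additive] [S'.Additive] [S''.Additive]
    [J'.Additive] [J.Additive] [JJ.Additive]
    (a : PP ⟶ P' ⋙ P) (b : JJ ⟶ J' ⋙ J) (τ : P ⋙ S ⟶ S' ⋙ J) (τ' : P' ⋙ S' ⟶ S'' ⋙ J')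
    (ττ : PP ⋙ S ⟶ S'' ⋙ JJ)
    (h : ∀ A, S.map (a.app A) ≫ τ.app (P'.obj A) ≫ J.map (τ'.app A) =
      ττ.app A ≫ b.app (S''.obj A)) (K : HomotopyCategory.Plus C'') :
    S.mapHomotopyCategoryPlus.map (splitMap a K) ≫
        squareMap τ (P'.mapHomotopyCategoryPlus.obj K) ≫
          J.mapHomotopyCategoryPlus.map (squareMap τ' K) =
      squareMap ττ K ≫ splitMap b (S''.mapHomotopyCategoryPlus.obj K) := by
  ext
  change (HomotopyCategory.quotient _ _).map _ = (HomotopyCategory.quotient _ _).map _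
  congr 1
  ext i
  exact h (K.obj.as.X i)

lemma squareMap_collapse {P : C ⥤ C} {S : C ⥤ D} {J : D ⥤ D} [P.Additive] [S.Additive] [J.Additive]
    (p : P ⟶ 𝟭 C) (q : J ⟶ 𝟭 D) (τ : P ⋙ S ⟶ S ⋙ J)
    (h : ∀ A, τ.app A ≫ q.app (S.obj A) = S.map (p.app A)) (K : HomotopyCategory.Plus C) :
    squareMap τ K ≫ collapseMap q (S.mapHomotopyCategoryPlus.obj K) =
      S.mapHomotopyCategoryPlus.map (collapseMap p K) := by
  ext
  change (HomotopyCategory.quotient _ _).map _ = (HomotopyCategory.quotient _ _).map _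
  congr 1
  ext i
  exact h (K.obj.as.X i)

lemma splitMap_collapse {J : D ⥤ D} {S : D ⥤ E} [S.Additive] [J.Additive]
    (q : J ⟶ 𝟭 D) (a : S ⟶ J ⋙ S)
    (h : ∀ A, a.app A ≫ S.map (q.app A) = 𝟙 _) (K : HomotopyCategory.Plus D) :
    splitMap a K ≫ S.mapHomotopyCategoryPlus.map (collapseMap q K) = 𝟙 _ := by
  ext
  change (HomotopyCategory.quotient _ _).map _ = (HomotopyCategory.quotient _ _).map (𝟙 _)
  congr 1
  ext i
  exact h (K.obj.as.X i)

lemma mapSingle_naturality {F : C ⥤ D} [F.Additive] {A B : C} (f : A ⟶ B) :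
    (HomotopyCategory.Plus.singleFunctor D 0).map (F.map f) ≫ mapSingle F B =
      mapSingle F A ≫ F.mapHomotopyCategoryPlus.map
        ((HomotopyCategory.Plus.singleFunctor C 0).map f) := by
  ext
  change (HomotopyCategory.quotient _ _).map (((CochainComplex.singleFunctor D 0).map (F.map f)) ≫
      (F.mapCochainComplexSingleFunctor 0).inv.app B) = (HomotopyCategory.quotient _ _).map
      ((F.mapCochainComplexSingleFunctor 0).inv.app A ≫ _)
  congr 1
  exact (F.mapCochainComplexSingleFunctor 0).inv.naturality f

/-- Maps out of a complex concentrated in degree `0` are determined in degree `0`, where the claim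
is naturality of `a` up to the identifications of the degree `0` term with the object. -/
lemma mapSingle_split {F : C ⥤ D} {G : D ⥤ E} {H : C ⥤ E} [F.Additive] [G.Additive] [H.Additive]
    (a : H ⟶ F ⋙ G) (A : C) :
    mapSingle H A ≫ splitMap a ((HomotopyCategory.Plus.singleFunctor C 0).obj A) =
      (HomotopyCategory.Plus.singleFunctor E 0).map (a.app A) ≫ mapSingle G (F.obj A) ≫
        G.mapHomotopyCategoryPlus.map (mapSingle F A) := by
  ext
  change (HomotopyCategory.quotient _ _).map ((H.mapCochainComplexSingleFunctor 0).inv.app A ≫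
      (NatTrans.mapHomologicalComplex a _).app _) =
    (HomotopyCategory.quotient _ _).map ((CochainComplex.singleFunctor E 0).map (a.app A) ≫
      (G.mapCochainComplexSingleFunctor 0).inv.app (F.obj A) ≫
      (G.mapHomologicalComplex _).map ((F.mapCochainComplexSingleFunctor 0).inv.app A))
  congr 1
  refine HomologicalComplex.from_single_hom_ext ?_
  change ((HomologicalComplex.singleMapHomologicalComplex H _ 0).inv.app A).f 0 ≫
      a.app (((HomologicalComplex.single C _ 0).obj A).X 0) =
    ((HomologicalComplex.single E _ 0).map (a.app A)).f 0 ≫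
      ((HomologicalComplex.singleMapHomologicalComplex G _ 0).inv.app (F.obj A)).f 0 ≫
      G.map (((HomologicalComplex.singleMapHomologicalComplex F _ 0).inv.app A).f 0)
  rw [HomologicalComplex.singleMapHomologicalComplex_inv_app_self,
    HomologicalComplex.singleMapHomologicalComplex_inv_app_self,
    HomologicalComplex.singleMapHomologicalComplex_inv_app_self,
    HomologicalComplex.single_map_f_self]
  -- The identifications are replaced by arbitrary isomorphisms, which cancel formally.
  have key {X : C} (x : X ≅ A) {Y : D} (y : Y ≅ F.obj A) {Z : E} (z : Z ≅ G.obj (F.obj A)) {W : E}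
      (w : W ≅ H.obj A) : (w.hom ≫ H.map x.inv) ≫ a.app X =
      (w.hom ≫ a.app A ≫ z.inv) ≫ (z.hom ≫ G.map y.inv) ≫ G.map (y.hom ≫ F.map x.inv) := by
    simp [← Functor.map_comp]
  exact key _ _ _ _

lemma mapSingle_collapse {F : C ⥤ C} [F.Additive] (a : F ⟶ 𝟭 C) (A : C) :
    mapSingle F A ≫ collapseMap a ((HomotopyCategory.Plus.singleFunctor C 0).obj A) =
      (HomotopyCategory.Plus.singleFunctor C 0).map (a.app A) := by
  ext
  change (HomotopyCategory.quotient _ _).map ((F.mapCochainComplexSingleFunctor 0).inv.app A ≫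
      (NatTrans.mapHomologicalComplex a _).app _) =
    (HomotopyCategory.quotient _ _).map ((CochainComplex.singleFunctor C 0).map (a.app A))
  congr 1
  refine HomologicalComplex.from_single_hom_ext ?_
  change ((HomologicalComplex.singleMapHomologicalComplex F _ 0).inv.app A).f 0 ≫
      a.app (((HomologicalComplex.single C _ 0).obj A).X 0) =
    ((HomologicalComplex.single C _ 0).map (a.app A)).f 0
  rw [HomologicalComplex.singleMapHomologicalComplex_inv_app_self,
    HomologicalComplex.single_map_f_self]
  have key {X : C} (x : X ≅ A) {W : C} (w : W ≅ F.obj A) :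
      (w.hom ≫ F.map x.inv) ≫ a.app X = w.hom ≫ a.app A ≫ x.inv := by
    simp
  exact key _ _

end HomotopyPlus


/-- The identification of `S(P(K))` with `(P ⋙ S)(K)` for complexes `K`. -/
def joinMap (P : C ⥤ D) (S : D ⥤ E) [P.Additive] [S.Additive] (K : HomotopyCategory.Plus C) :
    S.mapHomotopyCategoryPlus.obj (P.mapHomotopyCategoryPlus.obj K) ⟶
      (P ⋙ S).mapHomotopyCategoryPlus.obj K :=
  (homotopyPlusMap (𝟙 (P ⋙ S))).app K

/-- Both maps are the identity in each degree; they only mediate between `P ⋙ S` applied to a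
complex and `P`, `S` applied successively. -/
lemma joinMap_splitMap (P : C ⥤ D) (S : D ⥤ E) [P.Additive] [S.Additive]
    (K : HomotopyCategory.Plus C) : joinMap P S K ≫ splitMap (𝟙 (P ⋙ S)) K = 𝟙 _ := by
  ext
  change (HomotopyCategory.quotient _ _).map _ = (HomotopyCategory.quotient _ _).map (𝟙 _)
  congr 1
  ext i
  exact Category.id_comp _

instance (P : C ⥤ D) (S : D ⥤ E) [P.Additive] [S.Additive] (K : HomotopyCategory.Plus C) :
    IsIso (joinMap P S K) := by
  refine ⟨splitMap (𝟙 (P ⋙ S)) K, joinMap_splitMap P S K, ?_⟩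
  ext
  change (HomotopyCategory.quotient _ _).map _ = (HomotopyCategory.quotient _ _).map (𝟙 _)
  congr 1
  ext i
  exact Category.id_comp _

lemma squareMap_eq {D' : Type*} [Category* D'] [Abelian D'] {P : C ⥤ D} {S : D ⥤ E} {S' : C ⥤ D'}
    {J : D' ⥤ E} [P.Additive] [S.Additive] [S'.Additive] [J.Additive] (τ : P ⋙ S ⟶ S' ⋙ J)
    (K : HomotopyCategory.Plus C) :
    joinMap P S K ≫ (homotopyPlusMap τ).app K ≫ splitMap (𝟙 (S' ⋙ J)) K = squareMap τ K := by
  ext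
  change (HomotopyCategory.quotient _ _).map _ = (HomotopyCategory.quotient _ _).map _
  congr 1
  ext i
  exact (Category.id_comp _).trans (Category.comp_id _)

/-! ### Derived functors tested against their units. -/

section Units

variable [HasDerivedCategory C] [HasDerivedCategory D] [HasDerivedCategory E]
  [EnoughInjectives C]

/-- Uniqueness in the universal property of a right derived functor. It reduces all coherence
statements below to complexes. -/
lemma rightDerivedFunctorPlus_hom_ext {F : C ⥤ D} [F.Additive]
    {T : DerivedCategory.Plus C ⥤ DerivedCategory.Plus D} {γ₁ γ₂ : F.rightDerivedFunctorPlus ⟶ T}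
    (h : ∀ K, F.rightDerivedFunctorPlusUnit.app K ≫ γ₁.app (Qh.obj K) =
      F.rightDerivedFunctorPlusUnit.app K ≫ γ₂.app (Qh.obj K)) : γ₁ = γ₂ :=
  Functor.rightDerived_ext _ F.rightDerivedFunctorPlusUnit (HomotopyCategory.Plus.quasiIso C) _ _ _
    (NatTrans.ext (funext h))

lemma unit_naturality (F : C ⥤ D) [F.Additive] {K L : HomotopyCategory.Plus C} (f : K ⟶ L) :
    Qh.map (F.mapHomotopyCategoryPlus.map f) ≫ F.rightDerivedFunctorPlusUnit.app L =
      F.rightDerivedFunctorPlusUnit.app K ≫ F.rightDerivedFunctorPlus.map (Qh.map f) :=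
  F.rightDerivedFunctorPlusUnit.naturality f

lemma toDerived_naturality (F : C ⥤ D) [F.Additive] {A B : C} (f : A ⟶ B) :
    (DerivedCategory.Plus.singleFunctor D 0).map (F.map f) ≫ toDerived F B =
      toDerived F A ≫ F.rightDerivedFunctorPlus.map
        ((DerivedCategory.Plus.singleFunctor C 0).map f) := by
  change Qh.map ((HomotopyCategory.Plus.singleFunctor D 0).map (F.map f)) ≫ _ ≫ _ =
    (_ ≫ _) ≫ F.rightDerivedFunctorPlus.map
      (Qh.map ((HomotopyCategory.Plus.singleFunctor C 0).map f))
  rw [← Functor.map_comp_assoc, mapSingle_naturality, Functor.map_comp_assoc, unit_naturality,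
    Category.assoc]

/-- The natural transformation `RF ⟶ 𝟭` induced by `F ⟶ 𝟭`. -/
def derivedCollapse {F : C ⥤ C} [F.Additive] (τ : F ⟶ 𝟭 C) :
    F.rightDerivedFunctorPlus ⟶ 𝟭 (DerivedCategory.Plus C) :=
  Functor.rightDerivedDesc _ F.rightDerivedFunctorPlusUnit (HomotopyCategory.Plus.quasiIso C) _
    { app := fun K => Qh.map (collapseMap τ K)
      naturality := fun K L f => by
        change Qh.map _ ≫ _ = _ ≫ Qh.map f
        rw [← Functor.map_comp, ← Functor.map_comp, collapseMap_naturality] }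

lemma unit_derivedCollapse {F : C ⥤ C} [F.Additive] (τ : F ⟶ 𝟭 C) (K : HomotopyCategory.Plus C) :
    F.rightDerivedFunctorPlusUnit.app K ≫ (derivedCollapse τ).app (Qh.obj K) =
      Qh.map (collapseMap τ K) :=
  Functor.rightDerived_fac_app _ F.rightDerivedFunctorPlusUnit
    (HomotopyCategory.Plus.quasiIso C) _ _ K

lemma toDerived_collapse {F : C ⥤ C} [F.Additive] (τ : F ⟶ 𝟭 C) (A : C) :
    toDerived F A ≫ (derivedCollapse τ).app ((DerivedCategory.Plus.singleFunctor C 0).obj A) =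
      (DerivedCategory.Plus.singleFunctor C 0).map (τ.app A) := by
  have h := unit_derivedCollapse τ ((HomotopyCategory.Plus.singleFunctor C 0).obj A)
  refine (Category.assoc _ _ _).trans ((congrArg _ h).trans ?_)
  exact (Qh.map_comp _ _).symm.trans (congrArg _ (mapSingle_collapse τ A))

variable [EnoughInjectives D]

lemma unit_derivedComp {F : C ⥤ D} {G : D ⥤ E} {H : C ⥤ E} [F.Additive] [G.Additive] [H.Additive]
    (e : F ⋙ G ≅ H) (K : HomotopyCategory.Plus C) :
    H.rightDerivedFunctorPlusUnit.app K ≫ (derivedComp e).app (Qh.obj K) =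
      Qh.map (splitMap e.inv K) ≫
        G.rightDerivedFunctorPlusUnit.app (F.mapHomotopyCategoryPlus.obj K) ≫
          G.rightDerivedFunctorPlus.map (F.rightDerivedFunctorPlusUnit.app K) :=
  Functor.rightDerived_fac_app _ H.rightDerivedFunctorPlusUnit
    (HomotopyCategory.Plus.quasiIso C) _ (derivedCompUnit e) K

lemma toDerived_derivedComp {F : C ⥤ D} {G : D ⥤ E} {H : C ⥤ E} [F.Additive] [G.Additive]
    [H.Additive] (e : F ⋙ G ≅ H) (A : C) :
    toDerived H A ≫ (derivedComp e).app ((DerivedCategory.Plus.singleFunctor C 0).obj A) =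
      (DerivedCategory.Plus.singleFunctor E 0).map (e.inv.app A) ≫ toDerived G (F.obj A) ≫
        G.rightDerivedFunctorPlus.map (toDerived F A) := by
  have h := unit_derivedComp e ((HomotopyCategory.Plus.singleFunctor C 0).obj A)
  have h' := unit_naturality G (mapSingle F A)
  have key : Qh.map (mapSingle H A) ≫ H.rightDerivedFunctorPlusUnit.app _ ≫
      (derivedComp e).app (Qh.obj ((HomotopyCategory.Plus.singleFunctor C 0).obj A)) =
    Qh.map ((HomotopyCategory.Plus.singleFunctor E 0).map (e.inv.app A)) ≫
      (Qh.map (mapSingle G (F.obj A)) ≫ G.rightDerivedFunctorPlusUnit.app _) ≫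
        G.rightDerivedFunctorPlus.map
          (Qh.map (mapSingle F A) ≫ F.rightDerivedFunctorPlusUnit.app _) := by
    rw [h, Functor.map_comp G.rightDerivedFunctorPlus, Category.assoc, ← reassoc_of% h',
      ← Functor.map_comp_assoc, mapSingle_split, Functor.map_comp_assoc, Functor.map_comp_assoc]
  exact (Category.assoc _ _ _).trans key

/-- The natural transformation `RP ⋙ RS ⟶ RS' ⋙ RJ` induced by `P ⋙ S ⟶ S' ⋙ J`, provided that
the canonical morphism `R(P ⋙ S) ⟶ RP ⋙ RS` is invertible. -/
def derivedSquare {D' : Type*} [Category* D'] [Abelian D'] [HasDerivedCategory D']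
    [EnoughInjectives D'] {P : C ⥤ D} {S : D ⥤ E} {S' : C ⥤ D'} {J : D' ⥤ E}
    [P.Additive] [S.Additive] [S'.Additive] [J.Additive] (τ : P ⋙ S ⟶ S' ⋙ J)
    [IsIso (derivedComp (Iso.refl (P ⋙ S)))] :
    P.rightDerivedFunctorPlus ⋙ S.rightDerivedFunctorPlus ⟶
      S'.rightDerivedFunctorPlus ⋙ J.rightDerivedFunctorPlus :=
  inv (derivedComp (Iso.refl (P ⋙ S))) ≫ derivedMap τ ≫ derivedComp (Iso.refl (S' ⋙ J))

lemma unit_derivedComp_refl {P : C ⥤ D} {S : D ⥤ E} [P.Additive] [S.Additive]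
    (K : HomotopyCategory.Plus C) :
    S.rightDerivedFunctorPlusUnit.app (P.mapHomotopyCategoryPlus.obj K) ≫
      S.rightDerivedFunctorPlus.map (P.rightDerivedFunctorPlusUnit.app K) =
    Qh.map (joinMap P S K) ≫ (P ⋙ S).rightDerivedFunctorPlusUnit.app K ≫
      (derivedComp (Iso.refl (P ⋙ S))).app (Qh.obj K) := by
  rw [unit_derivedComp, ← Functor.map_comp_assoc, Iso.refl_inv, joinMap_splitMap, CategoryTheory.Functor.map_id,
    Category.id_comp]

/-- Natural transformations from `RP ⋙ RS` are determined by their values on complexes if the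
canonical morphism `R(P ⋙ S) ⟶ RP ⋙ RS` is invertible. -/
lemma derivedComp_hom_ext {P : C ⥤ D} {S : D ⥤ E} [P.Additive] [S.Additive]
    [IsIso (derivedComp (Iso.refl (P ⋙ S)))] {T : DerivedCategory.Plus C ⥤ DerivedCategory.Plus E}
    {γ₁ γ₂ : P.rightDerivedFunctorPlus ⋙ S.rightDerivedFunctorPlus ⟶ T}
    (h : ∀ K, S.rightDerivedFunctorPlusUnit.app (P.mapHomotopyCategoryPlus.obj K) ≫
        S.rightDerivedFunctorPlus.map (P.rightDerivedFunctorPlusUnit.app K) ≫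
          γ₁.app (Qh.obj K) =
      S.rightDerivedFunctorPlusUnit.app (P.mapHomotopyCategoryPlus.obj K) ≫
        S.rightDerivedFunctorPlus.map (P.rightDerivedFunctorPlusUnit.app K) ≫
          γ₂.app (Qh.obj K)) : γ₁ = γ₂ := by
  rw [← cancel_epi (derivedComp (Iso.refl (P ⋙ S)))]
  refine rightDerivedFunctorPlus_hom_ext fun K => ?_
  have := h K
  have hu := unit_derivedComp_refl (P := P) (S := S) K
  rw [reassoc_of% hu, reassoc_of% hu, cancel_epi] at this
  exact this

/-- This characterises `derivedSquare` without mentioning the inverse in its definition: on the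
composite of the two units, that inverse cancels against `unit_derivedComp_refl`. -/
lemma unit_derivedSquare {D' : Type*} [Category* D'] [Abelian D'] [HasDerivedCategory D']
    [EnoughInjectives D'] {P : C ⥤ D} {S : D ⥤ E} {S' : C ⥤ D'} {J : D' ⥤ E}
    [P.Additive] [S.Additive] [S'.Additive] [J.Additive] (τ : P ⋙ S ⟶ S' ⋙ J)
    [IsIso (derivedComp (Iso.refl (P ⋙ S)))] (K : HomotopyCategory.Plus C) :
    S.rightDerivedFunctorPlusUnit.app (P.mapHomotopyCategoryPlus.obj K) ≫
        S.rightDerivedFunctorPlus.map (P.rightDerivedFunctorPlusUnit.app K) ≫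
          (derivedSquare τ).app (Qh.obj K) =
      Qh.map (squareMap τ K) ≫
        J.rightDerivedFunctorPlusUnit.app (S'.mapHomotopyCategoryPlus.obj K) ≫
          J.rightDerivedFunctorPlus.map (S'.rightDerivedFunctorPlusUnit.app K) := by
  have h₁ := unit_derivedComp_refl (P := P) (S := S) K
  have h₂ := unit_derivedComp (Iso.refl (S' ⋙ J)) K
  have h₃ : (P ⋙ S).rightDerivedFunctorPlusUnit.app K ≫ (derivedMap τ).app (Qh.obj K) =
      Qh.map ((homotopyPlusMap τ).app K) ≫ (S' ⋙ J).rightDerivedFunctorPlusUnit.app K :=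
    Functor.rightDerivedNatTrans_app _ _ (P ⋙ S).rightDerivedFunctorPlusUnit
      (S' ⋙ J).rightDerivedFunctorPlusUnit (HomotopyCategory.Plus.quasiIso C)
      (Functor.whiskerRight (homotopyPlusMap τ) Qh) K
  have h₄ : (derivedComp (Iso.refl (P ⋙ S))).app (Qh.obj K) ≫ (derivedSquare τ).app (Qh.obj K) =
      (derivedMap τ).app (Qh.obj K) ≫ (derivedComp (Iso.refl (S' ⋙ J))).app (Qh.obj K) := by
    rw [← NatTrans.comp_app, ← NatTrans.comp_app, derivedSquare, IsIso.hom_inv_id_assoc]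
  rw [reassoc_of% h₁, h₄, reassoc_of% h₃, h₂, ← squareMap_eq τ K, Functor.map_comp,
    Functor.map_comp, Category.assoc, Category.assoc]
  rfl

/-- The canonical morphisms `R(F ⋙ G) ⟶ RF ⋙ RG` are associative. -/
lemma derivedComp_assoc {M : Type*} [Category* M] [Abelian M] [HasDerivedCategory M]
    [EnoughInjectives E] {F : C ⥤ D} {G : D ⥤ E} {H : E ⥤ M} {FG : C ⥤ E} {GH : D ⥤ M} {T : C ⥤ M}
    [F.Additive] [G.Additive] [H.Additive] [FG.Additive] [GH.Additive] [T.Additive]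
    (a : F ⋙ G ≅ FG) (b : G ⋙ H ≅ GH) (c : FG ⋙ H ≅ T) (d : F ⋙ GH ≅ T)
    (h : ∀ A, c.inv.app A ≫ H.map (a.inv.app A) = d.inv.app A ≫ b.inv.app (F.obj A))
    (L : DerivedCategory.Plus C) :
    (derivedComp c).app L ≫ H.rightDerivedFunctorPlus.map ((derivedComp a).app L) =
      (derivedComp d).app L ≫ (derivedComp b).app (F.rightDerivedFunctorPlus.obj L) := by
  suffices derivedComp c ≫ Functor.whiskerRight (derivedComp a) H.rightDerivedFunctorPlus =
      derivedComp d ≫ Functor.whiskerLeft F.rightDerivedFunctorPlus (derivedComp b) from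
    congr_app this L
  refine rightDerivedFunctorPlus_hom_ext fun K => ?_
  have hc := unit_derivedComp c K
  have hd := unit_derivedComp d K
  have ha := unit_derivedComp a K
  have hb := unit_derivedComp b (F.mapHomotopyCategoryPlus.obj K)
  have hn := (derivedComp b).naturality (F.rightDerivedFunctorPlusUnit.app K)
  have hH := unit_naturality H (splitMap a.inv K)
  have hs := splitMap_assoc a.inv b.inv c.inv d.inv h K
  change T.rightDerivedFunctorPlusUnit.app K ≫ (derivedComp c).app (Qh.obj K) ≫
      H.rightDerivedFunctorPlus.map ((derivedComp a).app (Qh.obj K)) =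
    T.rightDerivedFunctorPlusUnit.app K ≫ (derivedComp d).app (Qh.obj K) ≫
      (derivedComp b).app (F.rightDerivedFunctorPlus.obj (Qh.obj K))
  dsimp only [Functor.comp_obj, Functor.comp_map] at hn
  rw [reassoc_of% hc, reassoc_of% hd, hn, reassoc_of% hb, ← Functor.map_comp, ha,
    Functor.map_comp H.rightDerivedFunctorPlus, ← reassoc_of% hH, ← Functor.map_comp_assoc, hs]
  simp only [Functor.map_comp, Category.assoc]

/-- Pasting of derived squares. -/
lemma derivedSquare_paste {B C' C'' D' D'' : Type*} [Category* B] [Abelian B]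
    [HasDerivedCategory B] [Category* C'] [Abelian C'] [Category* C'']
    [Abelian C''] [Category* D'] [Abelian D'] [Category* D''] [Abelian D'']
    [HasDerivedCategory C'] [HasDerivedCategory C''] [HasDerivedCategory D']
    [HasDerivedCategory D''] [EnoughInjectives C'] [EnoughInjectives C''] [EnoughInjectives D']
    [EnoughInjectives D'']
    {P' : C'' ⥤ C'} {P : C' ⥤ C} {PP : C'' ⥤ C} {S : C ⥤ B} {S' : C' ⥤ D'} {S'' : C'' ⥤ D''}
    {J' : D'' ⥤ D'} {J : D' ⥤ B} {JJ : D'' ⥤ B}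
    [P'.Additive] [P.Additive] [PP.Additive] [S.Additive] [S'.Additive] [S''.Additive]
    [J'.Additive] [J.Additive] [JJ.Additive]
    (a : P' ⋙ P ≅ PP) (b : J' ⋙ J ≅ JJ) (τ : P ⋙ S ⟶ S' ⋙ J) (τ' : P' ⋙ S' ⟶ S'' ⋙ J')
    (ττ : PP ⋙ S ⟶ S'' ⋙ JJ)
    [IsIso (derivedComp (Iso.refl (P ⋙ S)))] [IsIso (derivedComp (Iso.refl (P' ⋙ S')))]
    [IsIso (derivedComp (Iso.refl (PP ⋙ S)))]
    (h : ∀ A, S.map (a.inv.app A) ≫ τ.app (P'.obj A) ≫ J.map (τ'.app A) =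
      ττ.app A ≫ b.inv.app (S''.obj A)) (L : DerivedCategory.Plus C'') :
    S.rightDerivedFunctorPlus.map ((derivedComp a).app L) ≫
        (derivedSquare τ).app (P'.rightDerivedFunctorPlus.obj L) ≫
          J.rightDerivedFunctorPlus.map ((derivedSquare τ').app L) =
      (derivedSquare ττ).app L ≫ (derivedComp b).app (S''.rightDerivedFunctorPlus.obj L) := by
  -- The two sides are packaged as natural transformations out of `RPP ⋙ RS`, so that the
  -- extensionality principle for such composites applies.
  let γ₁ : PP.rightDerivedFunctorPlus ⋙ S.rightDerivedFunctorPlus ⟶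
      S''.rightDerivedFunctorPlus ⋙ J'.rightDerivedFunctorPlus ⋙ J.rightDerivedFunctorPlus :=
    Functor.whiskerRight (derivedComp a) S.rightDerivedFunctorPlus ≫
      Functor.whiskerLeft P'.rightDerivedFunctorPlus (derivedSquare τ) ≫
        Functor.whiskerRight (derivedSquare τ') J.rightDerivedFunctorPlus
  let γ₂ : PP.rightDerivedFunctorPlus ⋙ S.rightDerivedFunctorPlus ⟶
      S''.rightDerivedFunctorPlus ⋙ J'.rightDerivedFunctorPlus ⋙ J.rightDerivedFunctorPlus :=
    derivedSquare ττ ≫ Functor.whiskerLeft S''.rightDerivedFunctorPlus (derivedComp b)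
  suffices γ₁ = γ₂ from congr_app this L
  refine derivedComp_hom_ext fun K => ?_
  change S.rightDerivedFunctorPlusUnit.app (PP.mapHomotopyCategoryPlus.obj K) ≫
        S.rightDerivedFunctorPlus.map (PP.rightDerivedFunctorPlusUnit.app K) ≫
      S.rightDerivedFunctorPlus.map ((derivedComp a).app (Qh.obj K)) ≫
        (derivedSquare τ).app (P'.rightDerivedFunctorPlus.obj (Qh.obj K)) ≫
          J.rightDerivedFunctorPlus.map ((derivedSquare τ').app (Qh.obj K)) =
     S.rightDerivedFunctorPlusUnit.app (PP.mapHomotopyCategoryPlus.obj K) ≫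
        S.rightDerivedFunctorPlus.map (PP.rightDerivedFunctorPlusUnit.app K) ≫
      (derivedSquare ττ).app (Qh.obj K) ≫
        (derivedComp b).app (S''.rightDerivedFunctorPlus.obj (Qh.obj K))
  have ha := unit_derivedComp a K
  have hb := unit_derivedComp b (S''.mapHomotopyCategoryPlus.obj K)
  have hS := unit_naturality S (splitMap a.inv K)
  have hJ := unit_naturality J (squareMap τ' K)
  have hττ := unit_derivedSquare ττ K
  have hτ' := unit_derivedSquare τ' K
  have hτ := unit_derivedSquare τ (P'.mapHomotopyCategoryPlus.obj K)
  have hn := (derivedSquare τ).naturality (P'.rightDerivedFunctorPlusUnit.app K)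
  have hm := (derivedComp b).naturality (S''.rightDerivedFunctorPlusUnit.app K)
  have hs := squareMap_paste a.inv b.inv τ τ' ττ h K
  dsimp only [Functor.comp_obj, Functor.comp_map] at hn hm
  rw [reassoc_of% hττ, hm, reassoc_of% hb, ← reassoc_of% (Functor.map_comp Qh), ← hs,
    ← Functor.map_comp_assoc S.rightDerivedFunctorPlus, ha,
    Functor.map_comp S.rightDerivedFunctorPlus, Category.assoc,
    ← reassoc_of% hS, Functor.map_comp S.rightDerivedFunctorPlus, Category.assoc,
    reassoc_of% hn, reassoc_of% hτ, ← Functor.map_comp, ← Functor.map_comp]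
  simp only [Functor.map_comp, Category.assoc]
  have hJτ' := congrArg J.rightDerivedFunctorPlus.map hτ'
  simp only [Functor.map_comp] at hJτ'
  rw [hJτ', reassoc_of% hJ]

lemma derivedSquare_collapse {P : C ⥤ C} {S : C ⥤ D} {J : D ⥤ D} [P.Additive] [S.Additive]
    [J.Additive] (p : P ⟶ 𝟭 C) (q : J ⟶ 𝟭 D) (τ : P ⋙ S ⟶ S ⋙ J)
    [IsIso (derivedComp (Iso.refl (P ⋙ S)))]
    (h : ∀ A, τ.app A ≫ q.app (S.obj A) = S.map (p.app A)) (L : DerivedCategory.Plus C) :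
    (derivedSquare τ).app L ≫ (derivedCollapse q).app (S.rightDerivedFunctorPlus.obj L) =
      S.rightDerivedFunctorPlus.map ((derivedCollapse p).app L) := by
  let γ₁ : P.rightDerivedFunctorPlus ⋙ S.rightDerivedFunctorPlus ⟶ S.rightDerivedFunctorPlus :=
    derivedSquare τ ≫ Functor.whiskerLeft S.rightDerivedFunctorPlus (derivedCollapse q)
  let γ₂ : P.rightDerivedFunctorPlus ⋙ S.rightDerivedFunctorPlus ⟶ S.rightDerivedFunctorPlus :=
    Functor.whiskerRight (derivedCollapse p) S.rightDerivedFunctorPlus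
  suffices γ₁ = γ₂ from congr_app this L
  refine derivedComp_hom_ext fun K => ?_
  change S.rightDerivedFunctorPlusUnit.app (P.mapHomotopyCategoryPlus.obj K) ≫
        S.rightDerivedFunctorPlus.map (P.rightDerivedFunctorPlusUnit.app K) ≫
      (derivedSquare τ).app (Qh.obj K) ≫
        (derivedCollapse q).app (S.rightDerivedFunctorPlus.obj (Qh.obj K)) =
     S.rightDerivedFunctorPlusUnit.app (P.mapHomotopyCategoryPlus.obj K) ≫
        S.rightDerivedFunctorPlus.map (P.rightDerivedFunctorPlusUnit.app K) ≫
      S.rightDerivedFunctorPlus.map ((derivedCollapse p).app (Qh.obj K))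
  have hτ := unit_derivedSquare τ K
  have hm := (derivedCollapse q).naturality (S.rightDerivedFunctorPlusUnit.app K)
  have hp := unit_derivedCollapse p K
  have hq := unit_derivedCollapse q (S.mapHomotopyCategoryPlus.obj K)
  have hS := unit_naturality S (collapseMap p K)
  dsimp only [Functor.id_obj, Functor.id_map, Functor.comp_obj] at hm
  rw [reassoc_of% hτ, hm, reassoc_of% hq, ← Functor.map_comp_assoc, squareMap_collapse p q τ h,
    ← Functor.map_comp, hp, hS]

/-- With `J` the direct image along the identity, this exhibits the inverse of `derivedComp e`
explicitly, as needed for the identity square. -/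
lemma derivedComp_collapse {M : Type*} [Category* M] [Abelian M] [HasDerivedCategory M]
    {J : D ⥤ D} {S : D ⥤ M} [S.Additive] [J.Additive]
    (q : J ⟶ 𝟭 D) (e : J ⋙ S ≅ S) (h : ∀ A, e.inv.app A ≫ S.map (q.app A) = 𝟙 _)
    (L : DerivedCategory.Plus D) :
    (derivedComp e).app L ≫ S.rightDerivedFunctorPlus.map ((derivedCollapse q).app L) = 𝟙 _ := by
  suffices derivedComp e ≫ Functor.whiskerRight (derivedCollapse q) S.rightDerivedFunctorPlus =
    𝟙 S.rightDerivedFunctorPlus from congr_app this L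
  refine rightDerivedFunctorPlus_hom_ext fun K => ?_
  change S.rightDerivedFunctorPlusUnit.app K ≫ (derivedComp e).app (Qh.obj K) ≫
    S.rightDerivedFunctorPlus.map ((derivedCollapse q).app (Qh.obj K)) =
      S.rightDerivedFunctorPlusUnit.app K ≫ 𝟙 _
  have he := unit_derivedComp e K
  have hq := unit_derivedCollapse q K
  have hS := unit_naturality S (collapseMap q K)
  rw [reassoc_of% he, ← Functor.map_comp, hq, ← hS, ← Functor.map_comp_assoc,
    splitMap_collapse q e.inv h, CategoryTheory.Functor.map_id, Category.id_comp, Category.comp_id]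

end Units

end DerivedFunctoriality

/-! ### Formal pasting in arbitrary categories. -/

section Gluing

lemma comp_inv_comp_inv {C : Type*} [Category* C] {W X Y Z : C} {x : Z ⟶ Y} {x' : W ⟶ Z}
    {x'' : W ⟶ X} {g : X ⟶ Y} [IsIso x] [IsIso x'] [IsIso x''] (h : x'' ≫ g = x' ≫ x) :
    g ≫ inv x ≫ inv x' = inv x'' := by
  rw [← cancel_epi x'', reassoc_of% h]
  simp

/-- Functoriality of the morphisms `ΓS(k) ⟶ ΓSP(k') ⟶ ΓJS'(k') ⟶ Γ'S'(k')`, given the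
compatibility of each of the three steps with composition. -/
lemma paste_restriction {A A' A'' B B' B'' M : Type*} [Category* A] [Category* A'] [Category* A'']
    [Category* B] [Category* B'] [Category* B''] [Category* M]
    {S : A ⥤ B} {S' : A' ⥤ B'} {S'' : A'' ⥤ B''} {Γ : B ⥤ M} {Γ' : B' ⥤ M} {Γ'' : B'' ⥤ M}
    {P : A' ⥤ A} {P' : A'' ⥤ A'} {PP : A'' ⥤ A} {J : B' ⥤ B} {J' : B'' ⥤ B'} {JJ : B'' ⥤ B}
    {k : A} {k' : A'} {k'' : A''} {c : k ⟶ P.obj k'} {c' : k' ⟶ P'.obj k''} {cc : k ⟶ PP.obj k''}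
    {σ : P ⋙ S ⟶ S' ⋙ J} {σ' : P' ⋙ S' ⟶ S'' ⋙ J'} {σσ : PP ⋙ S ⟶ S'' ⋙ JJ}
    {b : J ⋙ Γ ⟶ Γ'} {b' : J' ⋙ Γ' ⟶ Γ''} {bb : JJ ⋙ Γ ⟶ Γ''} {m : PP ⟶ P' ⋙ P}
    {mJ : JJ ⟶ J' ⋙ J} (hc : cc ≫ m.app k'' = c ≫ P.map c')
    (hσ : S.map (m.app k'') ≫ σ.app (P'.obj k'') ≫ J.map (σ'.app k'') =
      σσ.app k'' ≫ mJ.app (S''.obj k''))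
    (hb : Γ.map (mJ.app (S''.obj k'')) ≫ b.app (J'.obj (S''.obj k'')) ≫ b'.app (S''.obj k'') =
      bb.app (S''.obj k'')) :
    (Γ.map (S.map c ≫ σ.app k') ≫ b.app (S'.obj k')) ≫
        Γ'.map (S'.map c' ≫ σ'.app k'') ≫ b'.app (S''.obj k'') =
      Γ.map (S.map cc ≫ σσ.app k'') ≫ bb.app (S''.obj k'') := by
  -- Two interchanges bring the six factors into the order of the hypotheses: `b` moves past the
  -- second base change, and `σ` past `c'`.
  have h₁ := b.naturality (S'.map c' ≫ σ'.app k'')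
  have h₂ := σ.naturality c'
  dsimp only [Functor.comp_map, Functor.comp_obj] at h₁ h₂
  rw [Category.assoc, ← reassoc_of% h₁, ← hb, ← Functor.map_comp_assoc, ← Functor.map_comp_assoc]
  congr 2
  rw [Category.assoc, Category.assoc, Functor.map_comp, ← reassoc_of% h₂, ← hσ,
    ← Functor.map_comp_assoc, ← Functor.map_comp_assoc, hc]

lemma collapse_restriction {A B M : Type*} [Category* A] [Category* B] [Category* M]
    {S : A ⥤ B} {Γ : B ⥤ M} {P : A ⥤ A} {J : B ⥤ B} {k : A} {c : k ⟶ P.obj k}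
    {σ : P ⋙ S ⟶ S ⋙ J} {b : J ⋙ Γ ⟶ Γ} {p : P ⟶ 𝟭 A} {q : J ⟶ 𝟭 B} (hc : c ≫ p.app k = 𝟙 k)
    (hσ : σ.app k ≫ q.app (S.obj k) = S.map (p.app k))
    (hb : b.app (S.obj k) = Γ.map (q.app (S.obj k))) :
    Γ.map (S.map c ≫ σ.app k) ≫ b.app (S.obj k) = 𝟙 _ := by
  rw [hb, ← Functor.map_comp, Category.assoc, hσ, ← Functor.map_comp, hc,
    CategoryTheory.Functor.map_id]
  exact CategoryTheory.Functor.map_id _ _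

end Gluing

/-! ### Functoriality of the restriction maps for direct images with proper supports. -/

section ShriekFunctoriality

variable {R : Type u} [CommRing R] {X Y X' Y' X'' Y'' : TopCat.{u}}

/-- The direct image of sheaves of `R`-modules. -/
abbrev pushSh (R : Type u) [CommRing R] (ψ : X' ⟶ X) : Sh R X' ⥤ Sh R X :=
  TopCat.Sheaf.pushforward (ModuleCat.{u} R) ψ

/-- Direct images compose. -/
def pushShComp (R : Type u) [CommRing R] (ψ' : X'' ⟶ X') (ψ : X' ⟶ X) :
    pushSh R ψ' ⋙ pushSh R ψ ≅ pushSh R (ψ' ≫ ψ) :=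
  Iso.refl _

/-- The direct image along the identity is the identity. -/
def pushShId (R : Type u) [CommRing R] (X : TopCat.{u}) : pushSh R (𝟙 X) ≅ 𝟭 (Sh R X) :=
  Iso.refl _

instance (f : X ⟶ Y) (ψ : X' ⟶ X) : IsIso (derivedComp (Iso.refl (pushSh R ψ ⋙ shriek f))) :=
  isIso_derivedComp _ (injective_pushforward ψ)

/-- The adjunction between constant sheaves and global sections. -/
abbrev constAdj (R : Type u) [CommRing R] (X : TopCat.{u}) :=
  constantSheafAdj (Opens.grothendieckTopology X) (ModuleCat.{u} R)
    (isTerminalTop : IsTerminal (⊤ : Opens X))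

lemma homEquiv_constSheafMap (ψ : X' ⟶ X) :
    (constAdj R X).homEquiv (ModuleCat.of R R) _ (constSheafMap R ψ) =
      (constAdj R X').unit.app (ModuleCat.of R R) :=
  Equiv.apply_symm_apply _ _

/-- Both sides have the same transpose under the constant sheaf adjunction, namely the unit for
`X''`: global sections of a direct image are global sections upstairs. -/
lemma constSheafMap_comp (ψ : X' ⟶ X) (ψ' : X'' ⟶ X') :
    constSheafMap R ψ ≫ (pushSh R ψ).map (constSheafMap R ψ') =
      constSheafMap R (ψ' ≫ ψ) ≫ (pushShComp R ψ' ψ).inv.app _ := by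
  apply ((constAdj R X).homEquiv (ModuleCat.of R R) _).injective
  have h := homEquiv_constSheafMap (R := R) ψ'
  refine ((constAdj R X).homEquiv_naturality_right _ _).trans ?_
  refine Eq.trans ?_ ((constAdj R X).homEquiv_naturality_right _ _).symm
  exact (congrArg (· ≫ ((pushSh R ψ).map (constSheafMap R ψ')).hom.app (op ⊤))
    (homEquiv_constSheafMap ψ)).trans (h.trans ((congrArg (· ≫
      ((pushShComp R ψ' ψ).inv.app (constSheaf R X'')).hom.app (op ⊤))
      (homEquiv_constSheafMap (R := R) (ψ' ≫ ψ))).trans (Category.comp_id _)).symm)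

lemma constSheafMap_id : constSheafMap R (𝟙 X) ≫ (pushShId R X).hom.app _ = 𝟙 _ := by
  apply ((constAdj R X).homEquiv (ModuleCat.of R R) _).injective
  refine ((constAdj R X).homEquiv_naturality_right _ _).trans ?_
  refine (congrArg (· ≫ ((pushShId R X).hom.app (constSheaf R X)).hom.app (op ⊤))
    (homEquiv_constSheafMap (R := R) (𝟙 X))).trans ?_
  exact (Category.comp_id _).trans ((constAdj R X).homEquiv_id _).symm

/-- Forgetting the support condition, every map in sight is the restriction of a section, so
transitivity of restriction suffices. -/
lemma shriekPushforward_paste (f : X ⟶ Y) (f' : X' ⟶ Y') (f'' : X'' ⟶ Y'') (ψ : X' ⟶ X)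
    (j : Y' ⟶ Y) (ψ' : X'' ⟶ X') (j' : Y'' ⟶ Y') (comm : f' ≫ j = ψ ≫ f)
    (comm' : f'' ≫ j' = ψ' ≫ f') (comm'' : f'' ≫ j' ≫ j = (ψ' ≫ ψ) ≫ f)
    (hψ : IsProperMap ψ) (hj : Function.Injective j)
    (hψ' : IsProperMap ψ') (hj' : Function.Injective j')
    (hψ'' : IsProperMap (ψ' ≫ ψ)) (hj'' : Function.Injective (j' ≫ j)) (A : Sh R X'') :
    (shriek f).map ((pushShComp R ψ' ψ).inv.app A) ≫
        (shriekPushforward f f' ψ j comm hψ hj).app ((pushSh R ψ').obj A) ≫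
          (pushSh R j).map ((shriekPushforward f' f'' ψ' j' comm' hψ' hj').app A) =
      (shriekPushforward f f'' (ψ' ≫ ψ) (j' ≫ j) comm'' hψ'' hj'').app A ≫
        (pushShComp R j' j).inv.app ((shriek f'').obj A) := by
  refine ObjectProperty.hom_ext _ (NatTrans.ext (funext fun U =>
    ModuleCat.hom_ext (LinearMap.ext fun s => Subtype.ext ?_)))
  exact res_res A _ _ _

lemma shriekPushforward_id (f : X ⟶ Y) (comm : f ≫ 𝟙 Y = 𝟙 X ≫ f)
    (hψ : IsProperMap (𝟙 X)) (hj : Function.Injective (𝟙 Y)) (A : Sh R X) :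
    (shriekPushforward f f (𝟙 X) (𝟙 Y) comm hψ hj).app A ≫
        (pushShId R Y).hom.app ((shriek f).obj A) = (shriek f).map ((pushShId R X).hom.app A) := by
  refine ObjectProperty.hom_ext _ (NatTrans.ext (funext fun U =>
    ModuleCat.hom_ext (LinearMap.ext fun s => Subtype.ext ?_)))
  exact res_self A _ _

/-- The canonical morphism `K ⟶ Rψ_* L` along which the restriction maps are defined. -/
def derivedConstMap (R : Type u) [CommRing R] (ψ : X' ⟶ X) :
    (DerivedCategory.Plus.singleFunctor (Sh R X) 0).obj (constSheaf R X) ⟶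
      (pushSh R ψ).rightDerivedFunctorPlus.obj
        ((DerivedCategory.Plus.singleFunctor (Sh R X') 0).obj (constSheaf R X')) :=
  (DerivedCategory.Plus.singleFunctor _ 0).map (constSheafMap R ψ) ≫
    toDerived (pushSh R ψ) (constSheaf R X')

lemma derivedConstMap_comp (ψ : X' ⟶ X) (ψ' : X'' ⟶ X') :
    derivedConstMap R (ψ' ≫ ψ) ≫ (derivedComp (pushShComp R ψ' ψ)).app _ =
      derivedConstMap R ψ ≫
        (pushSh R ψ).rightDerivedFunctorPlus.map (derivedConstMap R ψ') := by
  rw [derivedConstMap, derivedConstMap, derivedConstMap, Category.assoc, toDerived_derivedComp,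
    Functor.map_comp, Category.assoc, ← reassoc_of% (toDerived_naturality (pushSh R ψ)
      (constSheafMap R ψ')), ← Functor.map_comp_assoc, ← constSheafMap_comp,
    Functor.map_comp_assoc]

lemma derivedConstMap_id :
    derivedConstMap R (𝟙 X) ≫ (derivedCollapse (pushShId R X).hom).app _ = 𝟙 _ := by
  rw [derivedConstMap, Category.assoc, toDerived_collapse, ← Functor.map_comp, constSheafMap_id,
    CategoryTheory.Functor.map_id]

/-- Global sections of a direct image. -/
def sectionsPush (R : Type u) [CommRing R] (j : Y' ⟶ Y) :
    pushSh R j ⋙ globalSections Y ≅ globalSections Y' :=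
  Iso.refl _

instance (j : Y' ⟶ Y) : IsIso (derivedComp (sectionsPush R j)) :=
  isIso_derivedComp _ (injective_pushforward j)

/-- The natural transformation `RΓ(Y, Rj_* -) ⟶ RΓ(Y', -)`. -/
def derivedSectionsPush (R : Type u) [CommRing R] (j : Y' ⟶ Y) :
    (pushSh R j).rightDerivedFunctorPlus ⋙ (globalSections Y).rightDerivedFunctorPlus ⟶
      (globalSections Y').rightDerivedFunctorPlus :=
  inv (derivedComp (sectionsPush R j))

lemma derivedSectionsPush_app (j : Y' ⟶ Y) (K : DerivedCategory.Plus (Sh R Y')) :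
    (derivedSectionsPush R j).app K = inv ((derivedComp (sectionsPush R j)).app K) :=
  NatIso.isIso_inv_app _ _

/-- Associativity of `derivedComp` for `j'_*`, `j_*` and `Γ`, read for the inverses. -/
lemma derivedSectionsPush_comp (j : Y' ⟶ Y) (j' : Y'' ⟶ Y')
    (K : DerivedCategory.Plus (Sh R Y'')) :
    (globalSections Y).rightDerivedFunctorPlus.map ((derivedComp (pushShComp R j' j)).app K) ≫
      (derivedSectionsPush R j).app ((pushSh R j').rightDerivedFunctorPlus.obj K) ≫
        (derivedSectionsPush R j').app K = (derivedSectionsPush R (j' ≫ j)).app K := by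
  rw [derivedSectionsPush_app, derivedSectionsPush_app, derivedSectionsPush_app]
  exact comp_inv_comp_inv (derivedComp_assoc (pushShComp R j' j) (sectionsPush R j)
    (sectionsPush R (j' ≫ j)) (sectionsPush R j') (fun A => rfl) K)

lemma derivedSectionsPush_id (K : DerivedCategory.Plus (Sh R Y)) :
    (derivedSectionsPush R (𝟙 Y)).app K =
      (globalSections Y).rightDerivedFunctorPlus.map
        ((derivedCollapse (pushShId R Y).hom).app K) := by
  rw [derivedSectionsPush_app]
  exact IsIso.inv_eq_of_hom_inv_id
    (derivedComp_collapse (pushShId R Y).hom (sectionsPush R (𝟙 Y)) (fun A => rfl) K)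

/-- The restriction morphism has three ingredients: the map of constant sheaves, base change, and
`RΓ ∘ Rj_* ≅ RΓ`. Each composes by one of the preceding results. -/
lemma derivedRestriction_comp (f : X ⟶ Y) (f' : X' ⟶ Y') (f'' : X'' ⟶ Y'') (ψ : X' ⟶ X)
    (j : Y' ⟶ Y) (ψ' : X'' ⟶ X') (j' : Y'' ⟶ Y') (comm : f' ≫ j = ψ ≫ f)
    (comm' : f'' ≫ j' = ψ' ≫ f') (comm'' : f'' ≫ j' ≫ j = (ψ' ≫ ψ) ≫ f)
    (hψ : IsProperMap ψ) (hj : Function.Injective j)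
    (hψ' : IsProperMap ψ') (hj' : Function.Injective j')
    (hψ'' : IsProperMap (ψ' ≫ ψ)) (hj'' : Function.Injective (j' ≫ j)) :
    derivedRestriction R f f' ψ j comm hψ hj ≫ derivedRestriction R f' f'' ψ' j' comm' hψ' hj' =
      derivedRestriction R f f'' (ψ' ≫ ψ) (j' ≫ j) comm'' hψ'' hj'' :=
  paste_restriction
    (S := (shriek f).rightDerivedFunctorPlus) (S' := (shriek f').rightDerivedFunctorPlus)
    (S'' := (shriek f'').rightDerivedFunctorPlus)
    (b := derivedSectionsPush R j) (b' := derivedSectionsPush R j')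
    (bb := derivedSectionsPush R (j' ≫ j))
    (derivedConstMap_comp (R := R) ψ ψ')
    (derivedSquare_paste (pushShComp R ψ' ψ) (pushShComp R j' j) _ _ _
      (shriekPushforward_paste f f' f'' ψ j ψ' j' comm comm' comm'' hψ hj hψ' hj' hψ'' hj'') _)
    (derivedSectionsPush_comp j j' _)

lemma derivedRestriction_id (f : X ⟶ Y) (comm : f ≫ 𝟙 Y = 𝟙 X ≫ f)
    (hψ : IsProperMap (𝟙 X)) (hj : Function.Injective (𝟙 Y)) :
    derivedRestriction R f f (𝟙 X) (𝟙 Y) comm hψ hj = 𝟙 _ :=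
  collapse_restriction (S := (shriek f).rightDerivedFunctorPlus)
    (b := derivedSectionsPush R (𝟙 Y)) derivedConstMap_id
    (derivedSquare_collapse (pushShId R X).hom (pushShId R Y).hom _
      (shriekPushforward_id f comm hψ hj) _) (derivedSectionsPush_id _)

lemma shriekCohomologyMap_comp (f : X ⟶ Y) (f' : X' ⟶ Y') (f'' : X'' ⟶ Y'') (ψ : X' ⟶ X)
    (j : Y' ⟶ Y) (ψ' : X'' ⟶ X') (j' : Y'' ⟶ Y') (comm : f' ≫ j = ψ ≫ f)
    (comm' : f'' ≫ j' = ψ' ≫ f') (comm'' : f'' ≫ j' ≫ j = (ψ' ≫ ψ) ≫ f)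
    (hψ : IsProperMap ψ) (hj : Function.Injective j)
    (hψ' : IsProperMap ψ') (hj' : Function.Injective j')
    (hψ'' : IsProperMap (ψ' ≫ ψ)) (hj'' : Function.Injective (j' ≫ j)) (i : ℤ) :
    shriekCohomologyMap R f f' ψ j comm hψ hj i ≫
        shriekCohomologyMap R f' f'' ψ' j' comm' hψ' hj' i =
      shriekCohomologyMap R f f'' (ψ' ≫ ψ) (j' ≫ j) comm'' hψ'' hj'' i :=
  (Functor.map_comp _ _ _).symm.trans (congrArg _ (derivedRestriction_comp ..))

lemma shriekCohomologyMap_id (f : X ⟶ Y) (comm : f ≫ 𝟙 Y = 𝟙 X ≫ f)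
    (hψ : IsProperMap (𝟙 X)) (hj : Function.Injective (𝟙 Y)) (i : ℤ) :
    shriekCohomologyMap R f f (𝟙 X) (𝟙 Y) comm hψ hj i = 𝟙 _ :=
  (congrArg _ (derivedRestriction_id ..)).trans (CategoryTheory.Functor.map_id _ _)

end ShriekFunctoriality

/-! ### Passage from bundle homeomorphisms to the inverse limit. -/

section Comparison

open unitInterval

variable {G X : Type u} [TopologicalSpace G] [Group G] [TopologicalSpace X]
  {φ φ' : G →* (X ≃ₜ X)}

variable {R : Type u} [CommRing R] in
-- The side conditions depend on `ψ` and `j`, so equal maps have to be substituted rather than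
-- rewritten.
lemma shriekCohomologyMap_congr {X Y X' Y' : TopCat.{u}} (f : X ⟶ Y) (f' : X' ⟶ Y')
    {ψ₁ ψ₂ : X' ⟶ X} {j₁ j₂ : Y' ⟶ Y} (hψ : ψ₁ = ψ₂) (hj : j₁ = j₂) (comm₁ : f' ≫ j₁ = ψ₁ ≫ f)
    (comm₂ : f' ≫ j₂ = ψ₂ ≫ f) (h₁ : IsProperMap ψ₁) (h₂ : IsProperMap ψ₂)
    (h₃ : Function.Injective j₁) (h₄ : Function.Injective j₂) (i : ℤ) :
    shriekCohomologyMap R f f' ψ₁ j₁ comm₁ h₁ h₃ i =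
      shriekCohomologyMap R f f' ψ₂ j₂ comm₂ h₂ h₄ i := by
  subst hψ hj
  rfl

/-- The map on the cohomology of `R(π_n)_! ℂ` induced by a homeomorphism of bundles. -/
def stageMap (n : ℕ) (e : homotopyQuotient φ n ≃ₜ homotopyQuotient φ' n)
    (he : ∀ x, homotopyQuotient.proj φ' n (e x) = homotopyQuotient.proj φ n x) (i : ℤ) :
    stageCohomology φ' n i ⟶ stageCohomology φ n i :=
  shriekCohomologyMap CC.{u} (bundle φ' n) (bundle φ n) (TopCat.ofHom ⟨e, e.continuous⟩) (𝟙 _)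
    (by ext x; exact (he x).symm) e.isProperMap Function.injective_id i

lemma stageMap_comp_symm (n : ℕ) (e : homotopyQuotient φ n ≃ₜ homotopyQuotient φ' n)
    (he : ∀ x, homotopyQuotient.proj φ' n (e x) = homotopyQuotient.proj φ n x)
    (he' : ∀ x, homotopyQuotient.proj φ n (e.symm x) = homotopyQuotient.proj φ' n x) (i : ℤ) :
    stageMap n e he i ≫ stageMap n e.symm he' i = 𝟙 _ := by
  let c : TopCat.of (homotopyQuotient φ n) ⟶ TopCat.of (homotopyQuotient φ' n) :=
    TopCat.ofHom ⟨e, e.continuous⟩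
  let c' : TopCat.of (homotopyQuotient φ' n) ⟶ TopCat.of (homotopyQuotient φ n) :=
    TopCat.ofHom ⟨e.symm, e.symm.continuous⟩
  have h : c' ≫ c = 𝟙 (TopCat.of (homotopyQuotient φ' n)) := by
    ext x
    exact e.apply_symm_apply x
  have hid : IsProperMap (𝟙 (TopCat.of (homotopyQuotient φ' n))) := (Homeomorph.refl _).isProperMap
  have hp : IsProperMap (c' ≫ c) := by
    rw [h]
    exact hid
  have hj : Function.Injective (𝟙 (TopCat.of (BG G n))) := Function.injective_id
  have comm : bundle φ' n ≫ 𝟙 _ ≫ 𝟙 _ = (c' ≫ c) ≫ bundle φ' n := by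
    rw [h, Category.comp_id, Category.comp_id, Category.id_comp]
  have comm' : bundle φ' n ≫ 𝟙 _ = 𝟙 _ ≫ bundle φ' n := by
    rw [Category.comp_id, Category.id_comp]
  exact (shriekCohomologyMap_comp (bundle φ' n) (bundle φ n) (bundle φ' n) c (𝟙 _) c' (𝟙 _) _ _
    comm _ _ _ _ hp hj i).trans ((shriekCohomologyMap_congr _ _ h (Category.comp_id _) comm comm'
    hp hid _ hj i).trans (shriekCohomologyMap_id ..))

/-- By functoriality both composites are the restriction map of one and the same outer square, since
the homeomorphisms commute with the inclusions. -/
lemma stageRestriction_comp_stageMap (n : ℕ)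
    (e : ∀ n, homotopyQuotient φ n ≃ₜ homotopyQuotient φ' n)
    (he : ∀ n x, homotopyQuotient.proj φ' n (e n x) = homotopyQuotient.proj φ n x)
    (hincl : ∀ x, e (n + 1) (homotopyQuotient.incl φ n x) = homotopyQuotient.incl φ' n (e n x))
    (i : ℤ) :
    stageMap (n + 1) (e (n + 1)) (he (n + 1)) i ≫ stageRestriction φ n i =
      stageRestriction φ' n i ≫ stageMap n (e n) (he n) i := by
  let a : TopCat.of (homotopyQuotient φ n) ⟶ TopCat.of (homotopyQuotient φ (n + 1)) :=
    TopCat.ofHom ⟨homotopyQuotient.incl φ n,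
      (homotopyQuotient.isClosedEmbedding_incl φ n).continuous⟩
  let a' : TopCat.of (homotopyQuotient φ' n) ⟶ TopCat.of (homotopyQuotient φ' (n + 1)) :=
    TopCat.ofHom ⟨homotopyQuotient.incl φ' n,
      (homotopyQuotient.isClosedEmbedding_incl φ' n).continuous⟩
  let c (n : ℕ) : TopCat.of (homotopyQuotient φ n) ⟶ TopCat.of (homotopyQuotient φ' n) :=
    TopCat.ofHom ⟨e n, (e n).continuous⟩
  let b : TopCat.of (BG G n) ⟶ TopCat.of (BG G (n + 1)) :=
    TopCat.ofHom ⟨BG.incl n, BG.continuous_incl n⟩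
  have ha : IsProperMap (a ≫ c (n + 1)) := (e (n + 1)).isProperMap.comp
    (homotopyQuotient.isClosedEmbedding_incl φ n).isProperMap
  have ha' : IsProperMap (c n ≫ a') :=
    (homotopyQuotient.isClosedEmbedding_incl φ' n).isProperMap.comp (e n).isProperMap
  have hb : Function.Injective (b ≫ 𝟙 _) := BG.injective_incl n
  have hb' : Function.Injective (𝟙 _ ≫ b) := BG.injective_incl n
  have h₁ : bundle φ n ≫ b ≫ 𝟙 _ = (a ≫ c (n + 1)) ≫ bundle φ' (n + 1) := by
    ext ⟨p, x⟩
    exact (he (n + 1) (homotopyQuotient.incl φ n (Quotient.mk _ (p, x)))).symm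
  have h₂ : bundle φ n ≫ 𝟙 _ ≫ b = (c n ≫ a') ≫ bundle φ' (n + 1) := by
    have h : a ≫ c (n + 1) = c n ≫ a' := by
      ext x
      exact hincl x
    rw [← h, ← h₁, Category.id_comp, Category.comp_id]
  refine (shriekCohomologyMap_comp (bundle φ' (n + 1)) (bundle φ (n + 1)) (bundle φ n)
    (c (n + 1)) (𝟙 _) a b _ _ h₁ _ _ _ _ ha hb i).trans (Eq.trans ?_
    (shriekCohomologyMap_comp (bundle φ' (n + 1)) (bundle φ' n) (bundle φ n)
    a' b (c n) (𝟙 _) _ _ h₂ _ _ _ _ ha' hb' i).symm)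
  refine shriekCohomologyMap_congr _ _ ?_ ?_ _ _ _ _ _ _ i
  · ext x
    exact hincl x
  · rw [Category.id_comp, Category.comp_id]

/-- Compatible homeomorphisms of the bundles `X_φ(n)` and `X_φ'(n)` over `BG(n)` induce an
isomorphism in equivariant cohomology with compact supports. -/
def equivariantCompactEquiv (e : ∀ n, homotopyQuotient φ n ≃ₜ homotopyQuotient φ' n)
    (he : ∀ n x, homotopyQuotient.proj φ' n (e n x) = homotopyQuotient.proj φ n x)
    (hincl : ∀ n x, e (n + 1) (homotopyQuotient.incl φ n x) =
      homotopyQuotient.incl φ' n (e n x)) (i : ℤ) :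
    equivariantCompactFamilies φ i ≃ₗ[CC.{u}] equivariantCompactFamilies φ' i :=
  have he' : ∀ n x, homotopyQuotient.proj φ n ((e n).symm x) = homotopyQuotient.proj φ' n x :=
    fun n x => by rw [← he, Homeomorph.apply_symm_apply]
  have hincl' : ∀ n x, (e (n + 1)).symm (homotopyQuotient.incl φ' n x) =
      homotopyQuotient.incl φ n ((e n).symm x) := fun n x => by
    rw [Homeomorph.symm_apply_eq, hincl, Homeomorph.apply_symm_apply]
  have h₁ : ∀ n, stageMap n (e n) (he n) i ≫ stageMap n (e n).symm (he' n) i = 𝟙 _ :=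
    fun n => stageMap_comp_symm n (e n) (he n) (he' n) i
  have h₂ : ∀ n, stageMap n (e n).symm (he' n) i ≫ stageMap n (e n) (he n) i = 𝟙 _ :=
    fun n => stageMap_comp_symm n (e n).symm (he' n) (he n) i
  -- Pullback is contravariant, so the map from the `φ`-families to the `φ'`-families is induced by
  -- the inverse homeomorphisms. The shift to `n + 1` matches the limit over `n ≥ 1`.
  { toFun := fun s => ⟨fun n => (stageMap (n + 1) (e (n + 1)).symm (he' (n + 1)) i).hom (s.1 n),
      fun n => (ConcreteCategory.congr_hom (stageRestriction_comp_stageMap (n + 1)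
        (fun n => (e n).symm) he' (hincl' (n + 1)) i) (s.1 (n + 1))).trans
        (congrArg _ (s.2 n))⟩
    invFun := fun s => ⟨fun n => (stageMap (n + 1) (e (n + 1)) (he (n + 1)) i).hom (s.1 n),
      fun n => (ConcreteCategory.congr_hom (stageRestriction_comp_stageMap (n + 1)
        e he (hincl (n + 1)) i) (s.1 (n + 1))).trans (congrArg _ (s.2 n))⟩
    map_add' := fun s t => Subtype.ext (funext fun n => map_add _ _ _)
    map_smul' := fun c s => Subtype.ext (funext fun n => map_smul _ _ _)
    left_inv := fun s => Subtype.ext (funext fun n =>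
      ConcreteCategory.congr_hom (h₂ (n + 1)) (s.1 n))
    right_inv := fun s => Subtype.ext (funext fun n =>
      ConcreteCategory.congr_hom (h₁ (n + 1)) (s.1 n)) }

end Comparison

end DefAct

end

theorem mainTheorem6 {G X : Type u} [TopologicalSpace G] [Group G] [IsTopologicalGroup G]
    [LocallyCompactSpace G] [TopologicalSpace X] [T2Space X] [LocallyCompactSpace X]
    (ℋ : Subgroup (X ≃ₜ X)) (φ φ' : G →ₜ* ℋ) (h : DefAct.HomotopicThroughHoms φ φ') (i : ℤ) :
    Nonempty (DefAct.EquivariantCompactCohomology (ℋ.subtype.comp φ.toMonoidHom) i ≃ₗ[ℂ]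
      DefAct.EquivariantCompactCohomology (ℋ.subtype.comp φ'.toMonoidHom) i) := by
  obtain ⟨A, hA, h₀, h₁⟩ := h.exists_family
  let e := DefAct.equivariantCompactEquiv
    (DefAct.homotopyQuotient.homeomorph _ _ A hA h₀ h₁)
    (DefAct.homotopyQuotient.proj_homeomorph _ _ A hA h₀ h₁)
    (DefAct.homotopyQuotient.homeomorph_incl _ _ A hA h₀ h₁) i
  -- `ℂ` acts through its lift to the universe `u`, so linearity over the lift gives linearity over
  -- `ℂ`.
  exact ⟨{ e.toAddEquiv with map_smul' := fun c s => e.map_smul (ULift.up c) s }⟩
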